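/- Let $a,c\in\mathbb{C}$ with $c\notin\mathbb{Z}_{\le 0}$ and let $w\in\mathbb{R}$ with $w<-1$. Let ${}_2F_1(a,a;c;\cdot)$ be the Gauss hypergeometric function: the sum of the series $\sum_{k\ge 0}\frac{(a)_k(a)_k}{k!\,(c)_k}z^k$ for $|z|<1$, extended to $\mathbb{C}\setminus[1,\infty)$ by its (existing and unique) analytic continuation. Here $(x)_k=x(x+1)\cdots(x+k-1)$, $(x)_0=1$, and $\Psi=\Gamma'/\Gamma$. Then $${}_2F_1(a,a;c;w)=(-w)^{-a}\frac{\Gamma(c)}{\Gamma(a)\Gamma(c-a)}\sum_{k=0}^{\infty}w^{-k}\frac{(a)_k(a-c+1)_k}{(k!)^2}\Bigl(2\Psi(k+1)-\Psi(a+k)-\Psi(a-c+1+k)+\Psi(a-c+1)-\Psi(c-a)+\log(-w)\Bigr),$$ and the series converges absolutely. If $a\notin\mathbb{Z}_{\le 0}$ and $c-a\notin\mathbb{Z}$, every expression in the formula is defined and the formula is meant literally. For all $(a,c)$ with $c\notin\mathbb{Z}_{\le 0}$ it is meant as follows: the product of the factor in front of the sum and the $k$-th summand, as a function of those parameters $(a',c')$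 with $a',c'\notin\mathbb{Z}_{\le 0}$ and $c'-a'\notin\mathbb{Z}$, has for every $k\ge 0$ a limit $t_k$ as $(a',c')\to(a,c)$; the series $\sum_{k\ge 0} t_k$ converges absolutely, and ${}_2F_1(a,a;c;w)=\sum_{k\ge 0}t_k$. -/

import Mathlib

open Filter Topology

/-- The cut plane `ℂ ∖ [1, ∞)`. -/
def cutPlane : Set ℂ := {z : ℂ | ∀ x : ℝ, 1 ≤ x → z ≠ (x : ℂ)}

/-- `F` is (on `ℂ ∖ [1, ∞)`) the analytic continuation of the Gauss hypergeometric series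
`∑ (a)ₖ (b)ₖ / (k! (c)ₖ) zᵏ`, `|z| < 1`. -/
def IsGaussContinuation (a b c : ℂ) (F : ℂ → ℂ) : Prop :=
  AnalyticOnNhd ℂ F cutPlane ∧
    ∀ z : ℂ, ‖z‖ < 1 → HasSum (fun k : ℕ ↦ z ^ k *
      ((ascPochhammer ℂ k).eval a * (ascPochhammer ℂ k).eval b /
        ((Nat.factorial k : ℂ) * (ascPochhammer ℂ k).eval c))) (F z)

open Classical in
/-- The Gauss hypergeometric function `₂F₁(a, b; c; ·)` for `c` not a nonpositive integer: the
sum of the hypergeometric series in the unit disc, analytically continued to `ℂ ∖ [1, ∞)`. By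
`IsGaussContinuation.eqOn` below, the continuation is unique on `ℂ ∖ [1, ∞)`. -/
noncomputable def gaussHyp (a b c : ℂ) : ℂ → ℂ :=
  if h : ∃ F : ℂ → ℂ, IsGaussContinuation a b c F then h.choose else 0

theorem cutPlane_starConvex : StarConvex ℝ (0 : ℂ) cutPlane := by
  intro z hz s t hs ht hst x hx h
  rw [smul_zero, zero_add] at h
  have ht0 : 0 < t := by
    rcases ht.lt_or_eq with h' | h'
    · exact h'
    · exfalso
      rw [← h', zero_smul] at h
      have : (0 : ℝ) = x := by exact_mod_cast h
      linarith
  refine hz (x / t) ?_ ?_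
  · rw [le_div_iff₀ ht0]; linarith
  · rw [Complex.real_smul] at h
    have : (t : ℂ) ≠ 0 := by exact_mod_cast ht0.ne'
    push_cast
    rw [← h]
    field_simp

/-- Uniqueness of the analytic continuation. -/
theorem IsGaussContinuation.eqOn {a b c : ℂ} {F G : ℂ → ℂ}
    (hF : IsGaussContinuation a b c F) (hG : IsGaussContinuation a b c G) :
    Set.EqOn F G cutPlane := by
  have h0 : (0 : ℂ) ∈ cutPlane := by
    intro x hx h
    have : (0 : ℝ) = x := by exact_mod_cast h
    linarith
  refine hF.1.eqOn_of_preconnected_of_eventuallyEq hG.1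
    (cutPlane_starConvex.isPathConnected h0).isConnected.isPreconnected h0 ?_
  filter_upwards [Metric.ball_mem_nhds (0 : ℂ) one_pos] with z hz
  have hz' : ‖z‖ < 1 := by simpa using hz
  exact (hF.2 z hz').unique (hG.2 z hz')

/-- The parameters `(a, c)` at which every gamma and digamma value in the expansion is defined:
`a` and `c` are not nonpositive integers and `c - a` is not an integer (so neither `c - a` nor
`a - c + 1` is a nonpositive integer). -/
def regularParams : Set (ℂ × ℂ) :=
  {p | (∀ n : ℕ, p.1 ≠ -(n : ℂ)) ∧ (∀ n : ℕ, p.2 ≠ -(n : ℂ)) ∧ ∀ n : ℤ, p.2 - p.1 ≠ (n : ℂ)}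

/-- Every admissible parameter is a limit of parameters in `regularParams`, so that limits along
`𝓝[regularParams] (a, c)` are unique. -/
theorem neBot_regularParams (a c : ℂ) (hc : ∀ n : ℕ, c ≠ -(n : ℂ)) :
    (𝓝[regularParams] (a, c)).NeBot := by
  rw [← mem_closure_iff_nhdsWithin_neBot]
  have hcount : (Set.range (fun n : ℕ ↦ -(n : ℂ)) ∪
      Set.range (fun n : ℤ ↦ c - (n : ℂ))).Countable :=
    (Set.countable_range _).union (Set.countable_range _)
  have hd := hcount.dense_compl ℝ a
  refine map_mem_closure (f := fun x : ℂ ↦ (x, c)) (by fun_prop) hd ?_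
  intro x hx
  refine ⟨fun n h ↦ hx (Or.inl ⟨n, h.symm⟩), hc, fun n h ↦ hx (Or.inr ⟨n, ?_⟩)⟩
  change c - x = n at h
  change c - (n : ℂ) = x
  rw [← h]; ring

/-- The factor `(-w)^(-a) Γ(c) / (Γ(a) Γ(c - a))`. -/
noncomputable def expansionFactor (a c : ℂ) (w : ℝ) : ℂ :=
  (((-w : ℝ) : ℂ) ^ (-a)) * (Complex.Gamma c / (Complex.Gamma a * Complex.Gamma (c - a)))

/-- The `k`-th summand of the expansion in powers of `w⁻¹`. -/
noncomputable def expansionTerm (a c : ℂ) (w : ℝ) (k : ℕ) : ℂ :=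
  ((w : ℂ) ^ k)⁻¹ *
    ((ascPochhammer ℂ k).eval a * (ascPochhammer ℂ k).eval (a - c + 1) /
      (Nat.factorial k : ℂ) ^ 2) *
    (2 * Complex.digamma ((k : ℂ) + 1) - Complex.digamma (a + k)
      - Complex.digamma (a - c + 1 + k) + Complex.digamma (a - c + 1)
      - Complex.digamma (c - a) + (Real.log (-w) : ℂ))

/-! Put w = -s with s > 1, and start from Euler's integral ∫₀¹ t^(b-1) (1-t)^(d-1) (1+st)^(-a) dt
with a = b + δ, 0 < δ < 1, re b > 0, re d > 1. Expanding (1-t)^(d-1) leaves integrals ∫₀¹ t^(b+j-1)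
(1+st)^(-a) dt, each a beta value times s^(-b-j) minus a tail that expands in powers of s⁻¹
(`powIntegral_add_natCast`). Summing the double series gives two series, led by s^(-a) and s^(-b)
(`eulerIntegral_neg_expansion`). By the reflection formula both carry π / sin(πδ), with opposite
signs. This factor blows up as δ → 0, but the difference of the remaining factors (`diffGen`)
vanishes termwise at δ = 0, so the limit is the sum of the δ-derivatives at 0
(`hasSum_deriv_diffGen`). Powers of s contribute the logarithm, reciprocal gammas the digamma
values.

After multiplication by Γ(c) / (Γ(a) Γ(c-a)), with b = a and d = c - a, each derivative becomes
-Γ(c) times the derivative at 0 of `expGen`, which is entire in a, c and δ (`deriv_diffGen`). So the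
terms make sense for every a and every c off the poles of Γ. A rational ratio of consecutive terms
and Cauchy's estimate bound them locally uniformly, hence their sum is holomorphic in each
parameter. So is the left side: for re z < 1/2, Pfaff's transformation writes it as one convergent
series (`gaussHyp_eq_pfaffSum`). The identity theorem, in a and then in c, removes the restrictions
(`gaussHyp_eq_tsum_limitTerm`). On `regularParams` the terms are the literal summands
(`expansionFactor_mul_expansionTerm`); elsewhere they are limits by continuity. -/

/-! ### Uniform ratio test and series of holomorphic functions. -/

/-- Ratio test uniform in x: past some N the ratio is at most q < 1, so C q^k is a majorant once C
also absorbs the bounds of the terms up to N. -/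
theorem exists_summable_bound_of_ratio {X : Type*} {f : ℕ → X → ℂ} {s : Set X} {ρ : ℕ → ℝ} {r : ℝ}
    (hr : r < 1) (hρ : Tendsto ρ atTop (𝓝 r)) (hf : ∀ k, ∃ M, ∀ x ∈ s, ‖f k x‖ ≤ M)
    (hstep : ∀ᶠ k in atTop, ∀ x ∈ s, ‖f (k + 1) x‖ ≤ ρ k * ‖f k x‖) :
    ∃ u : ℕ → ℝ, Summable u ∧ ∀ k, ∀ x ∈ s, ‖f k x‖ ≤ u k := by
  -- The maximum with 0 makes q positive, since powers of q are inverted in C.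
  obtain ⟨q, hq, hq1⟩ : ∃ q, max r 0 < q ∧ q < 1 := exists_between (by simpa using hr)
  have hq0 : 0 < q := (le_max_right _ _).trans_lt hq
  have hrq : r < q := (le_max_left _ _).trans_lt hq
  obtain ⟨N, hN⟩ := eventually_atTop.1 (hstep.and (hρ.eventually_le_const hrq))
  choose M hM using hf
  set C : ℝ := ∑ i ∈ Finset.range (N + 1), |M i| * (q ^ i)⁻¹ with hC
  have hsmall : ∀ k ≤ N, ∀ x ∈ s, ‖f k x‖ ≤ C * q ^ k := by
    intro k hk x hx
    have h1 : |M k| * (q ^ k)⁻¹ ≤ C :=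
      Finset.single_le_sum (f := fun i ↦ |M i| * (q ^ i)⁻¹) (fun i _ ↦ by positivity)
        (Finset.mem_range.2 (by omega))
    calc ‖f k x‖ ≤ |M k| := (hM k x hx).trans (le_abs_self _)
      _ = |M k| * (q ^ k)⁻¹ * q ^ k := by field_simp
      _ ≤ C * q ^ k := by gcongr
  have hlarge : ∀ k, N ≤ k → ∀ x ∈ s, ‖f k x‖ ≤ C * q ^ k := by
    intro k hk
    induction k, hk using Nat.le_induction with
    | base => exact hsmall N le_rfl
    | succ k hk ih =>
      intro x hx
      calc ‖f (k + 1) x‖ ≤ ρ k * ‖f k x‖ := (hN k hk).1 x hx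
        _ ≤ q * ‖f k x‖ := by gcongr; exact (hN k hk).2
        _ ≤ q * (C * q ^ k) := by gcongr; exact ih x hx
        _ = C * q ^ (k + 1) := by ring
  refine ⟨fun k ↦ C * q ^ k, (summable_geometric_of_lt_one hq0.le hq1).mul_left C, fun k x hx ↦ ?_⟩
  rcases le_total k N with h | h
  exacts [hsmall k h x hx, hlarge k h x hx]

theorem differentiableOn_tsum_of_compact_bound {F : ℕ → ℂ → ℂ} {U : Set ℂ} (hU : IsOpen U)
    (hF : ∀ i, DifferentiableOn ℂ (F i) U)
    (hb : ∀ K ⊆ U, IsCompact K → ∃ u : ℕ → ℝ, Summable u ∧ ∀ i, ∀ x ∈ K, ‖F i x‖ ≤ u i) :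
    DifferentiableOn ℂ (fun x ↦ ∑' i, F i x) U := by
  intro x hx
  obtain ⟨ε, hε, hεU⟩ := Metric.nhds_basis_closedBall.mem_iff.1 (hU.mem_nhds hx)
  obtain ⟨u, hu, hle⟩ := hb _ hεU (isCompact_closedBall x ε)
  have := Complex.differentiableOn_tsum_of_summable_norm hu
    (fun i ↦ (hF i).mono (Metric.ball_subset_closedBall.trans hεU)) Metric.isOpen_ball
    (fun i w hw ↦ hle i w (Metric.ball_subset_closedBall hw))
  exact (this.differentiableAt (Metric.ball_mem_nhds x hε)).differentiableWithinAt

theorem tendsto_natCast_add_div_natCast_add (x y : ℝ) :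
    Tendsto (fun k : ℕ ↦ ((k : ℝ) + x) / ((k : ℝ) + y)) atTop (𝓝 1) := by
  have := tendsto_add_mul_div_add_mul_atTop_nhds x y 1 (one_ne_zero (α := ℝ))
  simpa [add_comm] using this

theorem norm_add_natCast_le {z : ℂ} {M : ℝ} (hz : ‖z‖ ≤ M) (k : ℕ) : ‖z + k‖ ≤ k + M := by
  calc ‖z + k‖ ≤ ‖z‖ + ‖(k : ℂ)‖ := norm_add_le _ _
    _ ≤ k + M := by rw [Complex.norm_natCast]; linarith

theorem sub_le_norm_add_natCast {z : ℂ} {M : ℝ} (hz : ‖z‖ ≤ M) (k : ℕ) :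
    (k : ℝ) + -M ≤ ‖z + k‖ := by
  have := norm_sub_norm_le (k : ℂ) (-z)
  rw [norm_neg, Complex.norm_natCast, sub_neg_eq_add, add_comm (k : ℂ)] at this
  linarith

theorem continuous_ascPochhammer_eval (k : ℕ) :
    Continuous fun z : ℂ ↦ (ascPochhammer ℂ k).eval z := (ascPochhammer ℂ k).continuous

theorem differentiable_ascPochhammer_eval (k : ℕ) :
    Differentiable ℂ fun z : ℂ ↦ (ascPochhammer ℂ k).eval z := (ascPochhammer ℂ k).differentiable

theorem ascPochhammer_eval_ne_zero {c : ℂ} (hc : ∀ n : ℕ, c ≠ -(n : ℂ)) (k : ℕ) :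
    (ascPochhammer ℂ k).eval c ≠ 0 := by
  induction k with
  | zero => simp
  | succ k ih =>
    rw [ascPochhammer_succ_eval]
    exact mul_ne_zero ih fun h ↦ hc k (eq_neg_of_add_eq_zero_left h)

/-! ### Hypergeometric and binomial series. -/

/-- The `k`-th term of the Gauss hypergeometric series. -/
noncomputable def hypTerm (a b c z : ℂ) (k : ℕ) : ℂ :=
  z ^ k * ((ascPochhammer ℂ k).eval a * (ascPochhammer ℂ k).eval b /
    ((Nat.factorial k : ℂ) * (ascPochhammer ℂ k).eval c))

/-- The sum of the Gauss hypergeometric series. -/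
noncomputable def hypSum (a b c z : ℂ) : ℂ := ∑' k, hypTerm a b c z k

theorem hypTerm_succ (a b c z : ℂ) (k : ℕ) : hypTerm a b c z (k + 1) =
    hypTerm a b c z k * ((a + k) * (b + k) / ((k + 1) * (c + k)) * z) := by
  simp only [hypTerm, ascPochhammer_succ_eval, Nat.factorial_succ, pow_succ]
  push_cast
  simp only [div_eq_mul_inv, mul_inv]
  ring

/-- All four parameters are functions on a compact space, so that this one bound yields summability
at a point (`X = Unit`) and holomorphy in the argument or in any parameter. -/
theorem exists_hypTerm_bound {X : Type*} [TopologicalSpace X] {a b c z : X → ℂ} {K : Set X}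
    (hK : IsCompact K) (ha : ContinuousOn a K) (hb : ContinuousOn b K) (hc : ContinuousOn c K)
    (hz : ContinuousOn z K) (hc' : ∀ x ∈ K, ∀ n : ℕ, c x ≠ -(n : ℂ)) (hz' : ∀ x ∈ K, ‖z x‖ < 1) :
    ∃ u : ℕ → ℝ, Summable u ∧ ∀ k, ∀ x ∈ K, ‖hypTerm (a x) (b x) (c x) (z x) k‖ ≤ u k := by
  obtain ⟨Ma, hMa⟩ := hK.exists_bound_of_continuousOn ha
  obtain ⟨Mb, hMb⟩ := hK.exists_bound_of_continuousOn hb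
  obtain ⟨Mc, hMc⟩ := hK.exists_bound_of_continuousOn hc
  obtain ⟨r, hr, hr'⟩ : ∃ r < 1, ∀ x ∈ K, ‖z x‖ ≤ r := by
    rcases K.eq_empty_or_nonempty with rfl | hne
    · exact ⟨0, one_pos, by simp⟩
    · obtain ⟨x, hx, hmax⟩ := hK.exists_isMaxOn hne hz.norm
      exact ⟨_, hz' x hx, fun y hy ↦ hmax hy⟩
  refine exists_summable_bound_of_ratio (r := r) hr
    (ρ := fun k ↦ (((k : ℝ) + Ma) / (k + 1)) * ((k + Mb) / (k + -Mc)) * r) ?_ ?_ ?_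
  · simpa using ((tendsto_natCast_add_div_natCast_add Ma 1).mul
      (tendsto_natCast_add_div_natCast_add Mb (-Mc))).mul_const r
  · intro k
    refine hK.exists_bound_of_continuousOn (f := fun x ↦ hypTerm (a x) (b x) (c x) (z x) k) ?_
    refine (hz.pow k).mul (ContinuousOn.div
      (((continuous_ascPochhammer_eval k).comp_continuousOn ha).mul
        ((continuous_ascPochhammer_eval k).comp_continuousOn hb))
      (continuousOn_const.mul ((continuous_ascPochhammer_eval k).comp_continuousOn hc)) ?_)
    intro x hx
    exact mul_ne_zero (by exact_mod_cast k.factorial_ne_zero)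
      (ascPochhammer_eval_ne_zero (hc' x hx) k)
  · filter_upwards [eventually_gt_atTop ⌈|Mc|⌉₊] with k hk x hx
    have hk' : 0 < (k : ℝ) + -Mc := by
      have := Nat.lt_of_ceil_lt hk
      linarith [le_abs_self Mc]
    rw [hypTerm_succ, norm_mul, mul_comm]
    gcongr
    rw [norm_mul, norm_div, norm_mul, norm_mul, mul_div_mul_comm]
    have h1 := norm_add_natCast_le (hMa x hx) k
    have h2 := norm_add_natCast_le (hMb x hx) k
    have h3 := sub_le_norm_add_natCast (hMc x hx) k
    have h4 : ‖(k : ℂ) + 1‖ = (k : ℝ) + 1 := by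
      exact_mod_cast Complex.norm_natCast (k + 1)
    rw [h4]
    have h5 := (norm_nonneg _).trans h1
    have h6 := (norm_nonneg _).trans h2
    gcongr
    exact hr' x hx

theorem summable_norm_hypTerm {a b c z : ℂ} (hc : ∀ n : ℕ, c ≠ -(n : ℂ)) (hz : ‖z‖ < 1) :
    Summable fun k ↦ ‖hypTerm a b c z k‖ := by
  obtain ⟨u, hu, hle⟩ := exists_hypTerm_bound (X := Unit) (a := fun _ ↦ a) (b := fun _ ↦ b)
    (c := fun _ ↦ c) (z := fun _ ↦ z) isCompact_univ continuousOn_const continuousOn_const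
    continuousOn_const continuousOn_const (fun _ _ ↦ hc) (fun _ _ ↦ hz)
  exact hu.of_nonneg_of_le (fun _ ↦ norm_nonneg _) fun k ↦ hle k () trivial

theorem differentiableOn_hypSum {a b c z : ℂ → ℂ} {U : Set ℂ} (hU : IsOpen U)
    (ha : DifferentiableOn ℂ a U) (hb : DifferentiableOn ℂ b U) (hc : DifferentiableOn ℂ c U)
    (hz : DifferentiableOn ℂ z U) (hc' : ∀ x ∈ U, ∀ n : ℕ, c x ≠ -(n : ℂ))
    (hz' : ∀ x ∈ U, ‖z x‖ < 1) :
    DifferentiableOn ℂ (fun x ↦ hypSum (a x) (b x) (c x) (z x)) U := by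
  refine differentiableOn_tsum_of_compact_bound hU
    (F := fun k x ↦ hypTerm (a x) (b x) (c x) (z x) k) (fun k ↦ ?_) ?_
  · refine (hz.pow k).mul (DifferentiableOn.div
      (((differentiable_ascPochhammer_eval k).comp_differentiableOn ha).mul
        ((differentiable_ascPochhammer_eval k).comp_differentiableOn hb))
      ((differentiableOn_const _).mul
        ((differentiable_ascPochhammer_eval k).comp_differentiableOn hc)) ?_)
    intro x hx
    exact mul_ne_zero (by exact_mod_cast k.factorial_ne_zero)
      (ascPochhammer_eval_ne_zero (hc' x hx) k)
  · intro K hKU hK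
    exact exists_hypTerm_bound hK (ha.continuousOn.mono hKU) (hb.continuousOn.mono hKU)
      (hc.continuousOn.mono hKU) (hz.continuousOn.mono hKU) (fun x hx ↦ hc' x (hKU hx))
      (fun x hx ↦ hz' x (hKU hx))

/-- The coefficients `(a)ₖ / k!` of `(1 - z) ^ (-a)`. -/
noncomputable def binCoef (a : ℂ) (k : ℕ) : ℂ := (ascPochhammer ℂ k).eval a / (Nat.factorial k : ℂ)

theorem succ_mul_binCoef_succ (a : ℂ) (k : ℕ) :
    ((k : ℂ) + 1) * binCoef a (k + 1) = (a + k) * binCoef a k := by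
  have h1 : (Nat.factorial k : ℂ) ≠ 0 := by exact_mod_cast k.factorial_ne_zero
  have h2 : (k : ℂ) + 1 ≠ 0 := by exact_mod_cast k.succ_ne_zero
  simp only [binCoef, ascPochhammer_succ_eval, Nat.factorial_succ]
  push_cast
  field_simp

/-- The binomial series is the hypergeometric series with b = c = 1 and inherits its absolute
convergence. -/
theorem hypTerm_one_one (a z : ℂ) (k : ℕ) : hypTerm a 1 1 z k = binCoef a k * z ^ k := by
  have : (ascPochhammer ℂ k).eval 1 ≠ 0 := ascPochhammer_eval_ne_zero (fun n h ↦ by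
    have := congrArg Complex.re h
    simp at this
    linarith [(Nat.cast_nonneg n : (0 : ℝ) ≤ n)]) k
  rw [hypTerm, mul_div_mul_right _ _ this, binCoef, mul_comm]

theorem summable_norm_binCoef_mul_pow (a : ℂ) {z : ℂ} (hz : ‖z‖ < 1) :
    Summable fun k ↦ ‖binCoef a k * z ^ k‖ := by
  simp_rw [← hypTerm_one_one]
  refine summable_norm_hypTerm (fun n h ↦ ?_) hz
  have := congrArg Complex.re h
  simp at this
  linarith [(Nat.cast_nonneg n : (0 : ℝ) ≤ n)]

theorem hasSum_one_sub_cpow (a : ℂ) {z : ℂ} (hz : ‖z‖ < 1) :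
    HasSum (fun k ↦ binCoef a k * z ^ k) ((1 - z) ^ (-a)) := by
  have h := (Complex.one_add_cpow_hasFPowerSeriesOnBall_zero (a := -a)).hasSum (y := -z)
    (by simpa [← ENNReal.ofReal_one, Metric.eball_ofReal] using hz)
  rw [zero_add, ← sub_eq_add_neg] at h
  refine h.congr_fun fun k ↦ ?_
  rw [binomialSeries_apply, List.ofFn_const, List.prod_replicate, Ring.choose_eq_smul,
    Polynomial.descPochhammer_smeval_eq_ascPochhammer,
    Polynomial.ascPochhammer_smeval_cast, Polynomial.ascPochhammer_smeval_eq_eval]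
  have h1 := ascPochhammer_eval_neg_eq_descPochhammer (R := ℂ) (-a) k
  rw [neg_neg, descPochhammer_eval_eq_ascPochhammer] at h1
  rw [binCoef, h1, neg_pow z k]
  simp only [smul_eq_mul, div_eq_mul_inv]
  ring

/-! ### Termwise integration and differentiation under the integral, against an integrable weight.
-/

-- The weight `g` carries the endpoint singularities, so only the factors `φ n` need uniform bounds.
-- Convergence is asked on the open interval because the binomial series of (1-t)^(d-1) is summed
-- only for t < 1.
open MeasureTheory in
theorem hasSum_intervalIntegral_mul {g : ℝ → ℂ} (hg : IntervalIntegrable g volume 0 1)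
    {φ : ℕ → ℝ → ℂ} {f : ℝ → ℂ} {u : ℕ → ℝ} (hu : Summable u)
    (hφ : ∀ n, ContinuousOn (φ n) (Set.Icc 0 1)) (hle : ∀ n, ∀ t ∈ Set.Icc (0 : ℝ) 1, ‖φ n t‖ ≤ u n)
    (hf : ∀ t ∈ Set.Ioo (0 : ℝ) 1, HasSum (fun n ↦ φ n t) (f t)) :
    HasSum (fun n ↦ ∫ t in (0 : ℝ)..1, g t * φ n t) (∫ t in (0 : ℝ)..1, g t * f t) := by
  have huI : Set.uIoc (0 : ℝ) 1 = Set.Ioc 0 1 := Set.uIoc_of_le zero_le_one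
  refine intervalIntegral.hasSum_integral_of_dominated_convergence (fun n t ↦ u n * ‖g t‖)
    (fun n ↦ ?_) (fun n ↦ ?_) ?_ ?_ ?_
  · rw [huI]
    rw [intervalIntegrable_iff, huI] at hg
    exact hg.aestronglyMeasurable.mul
      (((hφ n).mono Set.Ioc_subset_Icc_self).aestronglyMeasurable measurableSet_Ioc)
  · refine ae_of_all _ fun t ht ↦ ?_
    rw [huI] at ht
    rw [norm_mul, mul_comm]
    gcongr
    exact hle n t (Set.Ioc_subset_Icc_self ht)
  · exact ae_of_all _ fun t _ ↦ hu.mul_right _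
  · simp_rw [tsum_mul_right]
    exact hg.norm.const_mul _
  · filter_upwards [compl_mem_ae_iff.2 (measure_singleton (1 : ℝ))] with t ht1 ht
    rw [huI] at ht
    exact (hf t ⟨ht.1, lt_of_le_of_ne ht.2 ht1⟩).mul_left _

open MeasureTheory in
theorem differentiableOn_intervalIntegral_mul {g : ℝ → ℂ} (hg : IntervalIntegrable g volume 0 1)
    {φ φ' : ℂ → ℝ → ℂ} {U : Set ℂ} (hU : IsOpen U)
    (hφ : ContinuousOn (Function.uncurry φ) (U ×ˢ Set.Icc 0 1))
    (hφ' : ContinuousOn (Function.uncurry φ') (U ×ˢ Set.Icc 0 1))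
    (hd : ∀ z ∈ U, ∀ t ∈ Set.Icc (0 : ℝ) 1, HasDerivAt (fun z ↦ φ z t) (φ' z t) z) :
    DifferentiableOn ℂ (fun z ↦ ∫ t in (0 : ℝ)..1, g t * φ z t) U := by
  have huI : Set.uIoc (0 : ℝ) 1 = Set.Ioc 0 1 := Set.uIoc_of_le zero_le_one
  have hucc : Set.uIcc (0 : ℝ) 1 = Set.Icc 0 1 := Set.uIcc_of_le zero_le_one
  intro x hx
  obtain ⟨ε, hε, hεU⟩ := Metric.nhds_basis_closedBall.mem_iff.1 (hU.mem_nhds hx)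
  obtain ⟨M, hM⟩ := ((isCompact_closedBall x ε).prod isCompact_Icc).exists_bound_of_continuousOn
    (hφ'.mono (Set.prod_mono hεU subset_rfl))
  have hslice : ∀ {ψ : ℂ → ℝ → ℂ}, ContinuousOn (Function.uncurry ψ) (U ×ˢ Set.Icc 0 1) →
      ∀ z ∈ U, ContinuousOn (ψ z) (Set.uIcc 0 1) := fun hψ z hz ↦ by
    rw [hucc]
    exact hψ.comp (f := fun t ↦ (z, t)) (by fun_prop) (fun t ht ↦ ⟨hz, ht⟩)
  have hint : ∀ {ψ : ℂ → ℝ → ℂ}, ContinuousOn (Function.uncurry ψ) (U ×ˢ Set.Icc 0 1) →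
      ∀ z ∈ U, IntervalIntegrable (fun t ↦ g t * ψ z t) volume 0 1 := fun hψ z hz ↦
    hg.mul_continuousOn (hslice hψ z hz)
  have := intervalIntegral.hasDerivAt_integral_of_dominated_loc_of_deriv_le
    (μ := volume) (a := 0) (b := 1) (F := fun z t ↦ g t * φ z t) (F' := fun z t ↦ g t * φ' z t)
    (bound := fun t ↦ ‖g t‖ * M) (x₀ := x)
    (Metric.ball_mem_nhds x hε) ?_ (hint hφ x hx) ?_ ?_ (hg.norm.mul_const M) ?_
  · exact this.2.differentiableAt.differentiableWithinAt
  · filter_upwards [hU.mem_nhds hx] with z hz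
    exact (intervalIntegrable_iff.1 (hint hφ z hz)).aestronglyMeasurable
  · exact (intervalIntegrable_iff.1 (hint hφ' x hx)).aestronglyMeasurable
  · refine ae_of_all _ fun t ht z hz ↦ ?_
    rw [huI] at ht
    rw [norm_mul]
    gcongr
    exact hM (z, t) ⟨Metric.ball_subset_closedBall hz, Set.Ioc_subset_Icc_self ht⟩
  · refine ae_of_all _ fun t ht z hz ↦ ?_
    rw [huI] at ht
    exact (hd z (hεU (Metric.ball_subset_closedBall hz)) t (Set.Ioc_subset_Icc_self ht)).const_mul _

/-! ### Euler's integral and existence of the continuation. -/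

theorem isOpen_cutPlane : IsOpen cutPlane := by
  have : cutPlane = ((fun x : ℝ ↦ (x : ℂ)) '' Set.Ici 1)ᶜ := by
    ext z
    simp only [cutPlane, Set.mem_ofPred_eq, Set.mem_compl_iff, Set.mem_image, Set.mem_Ici, not_exists,
      not_and]
    exact forall₂_congr fun x _ ↦ ne_comm
  rw [this]
  exact (Complex.isometry_ofReal.isClosedEmbedding.isClosedMap _ isClosed_Ici).isOpen_compl

theorem mul_mem_cutPlane {z : ℂ} (hz : z ∈ cutPlane) {t : ℝ} (ht : t ∈ Set.Icc (0 : ℝ) 1) :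
    z * t ∈ cutPlane := by
  have := cutPlane_starConvex hz (sub_nonneg.2 ht.2) ht.1 (by ring)
  simpa [mul_comm] using this

theorem one_sub_mem_slitPlane {z : ℂ} (hz : z ∈ cutPlane) : 1 - z ∈ Complex.slitPlane := by
  rw [Complex.mem_slitPlane_iff]
  by_contra! h
  refine hz z.re ?_ (Complex.ext rfl ?_)
  · simpa using h.1
  · simpa using h.2

/-- Euler's integral `∫₀¹ t^(b-1) (1-t)^(d-1) (1-zt)^(-a) dt`. -/
noncomputable def eulerIntegral (a b d z : ℂ) : ℂ :=
  ∫ t in (0 : ℝ)..1, ((t : ℂ) ^ (b - 1) * (1 - (t : ℂ)) ^ (d - 1)) * (1 - z * t) ^ (-a)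

theorem differentiableOn_eulerIntegral (a : ℂ) {b d : ℂ} (hb : 0 < b.re) (hd : 0 < d.re) :
    DifferentiableOn ℂ (eulerIntegral a b d) cutPlane := by
  have hsl : ∀ p ∈ cutPlane ×ˢ Set.Icc (0 : ℝ) 1, 1 - p.1 * (p.2 : ℂ) ∈ Complex.slitPlane :=
    fun p hp ↦ one_sub_mem_slitPlane (mul_mem_cutPlane hp.1 hp.2)
  have hc : ∀ e : ℂ, ContinuousOn (fun p : ℂ × ℝ ↦ (1 - p.1 * (p.2 : ℂ)) ^ e)
      (cutPlane ×ˢ Set.Icc (0 : ℝ) 1) := fun e ↦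
    ContinuousOn.cpow (by fun_prop) continuousOn_const hsl
  refine differentiableOn_intervalIntegral_mul (Complex.betaIntegral_convergent hb hd)
    isOpen_cutPlane (φ := fun z t ↦ (1 - z * t) ^ (-a))
    (φ' := fun z t ↦ -a * (1 - z * t) ^ (-a - 1) * -(t : ℂ)) (hc _) ?_ ?_
  · exact (continuousOn_const.mul (hc _)).mul (by fun_prop)
  · intro z hz t ht
    have h1 : HasDerivAt (fun z : ℂ ↦ 1 - z * t) (-(t : ℂ)) z := by
      simpa using ((hasDerivAt_id z).mul_const (t : ℂ)).const_sub 1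
    exact h1.cpow_const (hsl (z, t) ⟨hz, ht⟩)

theorem ne_neg_natCast_of_re_pos {c : ℂ} (hc : 0 < c.re) (n : ℕ) : c ≠ -(n : ℂ) := by
  rintro rfl
  simp at hc
  linarith [(Nat.cast_nonneg n : (0 : ℝ) ≤ n)]

theorem Gamma_add_natCast {z : ℂ} (hz : ∀ n : ℕ, z ≠ -(n : ℂ)) (k : ℕ) :
    Complex.Gamma (z + k) = (ascPochhammer ℂ k).eval z * Complex.Gamma z := by
  induction k with
  | zero => simp
  | succ k ih =>
    have : z + k ≠ 0 := fun h ↦ hz k (eq_neg_of_add_eq_zero_left h)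
    rw [ascPochhammer_succ_eval, Nat.cast_succ, ← add_assoc, Complex.Gamma_add_one _ this, ih]
    ring

theorem betaIntegral_add_natCast {b d : ℂ} (hb : 0 < b.re) (hd : 0 < d.re) (k : ℕ) :
    Complex.betaIntegral (b + k) d = (ascPochhammer ℂ k).eval b / (ascPochhammer ℂ k).eval (b + d) *
      Complex.betaIntegral b d := by
  have hbd : 0 < (b + d).re := by simpa using add_pos hb hd
  have hbk : 0 < (b + k).re := by
    simp only [Complex.add_re, Complex.natCast_re]
    positivity
  rw [Complex.betaIntegral_eq_Gamma_mul_div _ _ hbk hd, Complex.betaIntegral_eq_Gamma_mul_div _ _ hb hd,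
    Gamma_add_natCast (ne_neg_natCast_of_re_pos hb), add_right_comm,
    Gamma_add_natCast (ne_neg_natCast_of_re_pos hbd)]
  have := ascPochhammer_eval_ne_zero (ne_neg_natCast_of_re_pos hbd) k
  have := Complex.Gamma_ne_zero_of_re_pos hbd
  field_simp

theorem betaIntegral_ne_zero {b d : ℂ} (hb : 0 < b.re) (hd : 0 < d.re) :
    Complex.betaIntegral b d ≠ 0 := by
  rw [Complex.betaIntegral_eq_Gamma_mul_div _ _ hb hd]
  exact div_ne_zero (mul_ne_zero (Complex.Gamma_ne_zero_of_re_pos hb)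
    (Complex.Gamma_ne_zero_of_re_pos hd))
    (Complex.Gamma_ne_zero_of_re_pos (by simpa using add_pos hb hd))

theorem hasSum_eulerIntegral (a : ℂ) {b d z : ℂ} (hb : 0 < b.re) (hd : 0 < d.re) (hz : ‖z‖ < 1) :
    HasSum (fun k ↦ Complex.betaIntegral b d * hypTerm a b (b + d) z k)
      (eulerIntegral a b d z) := by
  have key := hasSum_intervalIntegral_mul (Complex.betaIntegral_convergent hb hd)
    (φ := fun k t ↦ binCoef a k * (z * t) ^ k) (f := fun t ↦ (1 - z * t) ^ (-a))
    (summable_norm_binCoef_mul_pow a hz) (fun n ↦ by fun_prop) ?_ ?_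
  · refine key.congr_fun fun k ↦ ?_
    have : ∀ t ∈ Set.uIoc (0 : ℝ) 1, ((t : ℂ) ^ (b - 1) * (1 - (t : ℂ)) ^ (d - 1)) *
        (binCoef a k * (z * t) ^ k) =
        (binCoef a k * z ^ k) * ((t : ℂ) ^ (b + k - 1) * (1 - (t : ℂ)) ^ (d - 1)) := by
      intro t ht
      rw [Set.uIoc_of_le zero_le_one] at ht
      have ht0 : (t : ℂ) ≠ 0 := by exact_mod_cast ht.1.ne'
      rw [add_sub_right_comm, Complex.cpow_add _ _ ht0, Complex.cpow_natCast]
      ring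
    rw [intervalIntegral.integral_congr_ae (MeasureTheory.ae_of_all _ this),
      intervalIntegral.integral_const_mul, ← Complex.betaIntegral, betaIntegral_add_natCast hb hd,
      hypTerm, binCoef]
    simp only [div_eq_mul_inv, mul_inv]
    ring
  · intro n t ht
    have : ‖(t : ℂ)‖ ≤ 1 := by
      rw [Complex.norm_real, Real.norm_of_nonneg ht.1]; exact ht.2
    rw [mul_pow, ← mul_assoc, norm_mul, norm_pow (t : ℂ)]
    exact mul_le_of_le_one_right (norm_nonneg _) (pow_le_one₀ (norm_nonneg _) this)
  · intro t ht
    refine hasSum_one_sub_cpow a ?_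
    rw [norm_mul, Complex.norm_real, Real.norm_of_nonneg ht.1.le]
    nlinarith [norm_nonneg z, ht.1, ht.2]

theorem eulerIntegral_eq (a : ℂ) {b d z : ℂ} (hb : 0 < b.re) (hd : 0 < d.re) (hz : ‖z‖ < 1) :
    eulerIntegral a b d z = Complex.betaIntegral b d * hypSum a b (b + d) z := by
  rw [← (hasSum_eulerIntegral a hb hd hz).tsum_eq, tsum_mul_left, hypSum]

theorem add_one_ne_neg_natCast {c : ℂ} (hc : ∀ n : ℕ, c ≠ -(n : ℂ)) (n : ℕ) : c + 1 ≠ -(n : ℂ) := by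
  intro h
  refine hc (n + 1) ?_
  push_cast
  linear_combination h

theorem ascPochhammer_eval_succ_left (a : ℂ) (k : ℕ) :
    (ascPochhammer ℂ (k + 1)).eval a = a * (ascPochhammer ℂ k).eval (a + 1) := by
  simp [ascPochhammer_succ_left, Polynomial.eval_comp]

theorem IsGaussContinuation.eq_hypSum {a b c : ℂ} {F : ℂ → ℂ} (hF : IsGaussContinuation a b c F)
    {z : ℂ} (hz : ‖z‖ < 1) : F z = hypSum a b c z :=
  ((hF.2 z hz).tsum_eq).symm

theorem hasSum_natCast_mul_hypTerm {a b c z : ℂ} (hc : ∀ n : ℕ, c ≠ -(n : ℂ)) (hz : ‖z‖ < 1) :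
    HasSum (fun k ↦ k * hypTerm a b c z k) (z * deriv (hypSum a b c) z) := by
  obtain ⟨r, hzr, hr⟩ := exists_between hz
  obtain ⟨u, hu, hle⟩ := exists_hypTerm_bound (X := ℂ) (a := fun _ ↦ a) (b := fun _ ↦ b)
    (c := fun _ ↦ c) (z := fun z ↦ z) (isCompact_closedBall (0 : ℂ) r) continuousOn_const
    continuousOn_const continuousOn_const continuousOn_id (fun _ _ ↦ hc)
    (fun x hx ↦ (mem_closedBall_zero_iff.1 hx).trans_lt hr)
  have hd : ∀ (k : ℕ) (x : ℂ), HasDerivAt (fun z ↦ hypTerm a b c z k) (k * x ^ (k - 1) *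
      ((ascPochhammer ℂ k).eval a * (ascPochhammer ℂ k).eval b /
        ((Nat.factorial k : ℂ) * (ascPochhammer ℂ k).eval c))) x := fun k x ↦
    (hasDerivAt_pow k x).mul_const _
  have := Complex.hasSum_deriv_of_summable_norm hu (F := fun k z ↦ hypTerm a b c z k)
    (fun k ↦ (fun x _ ↦ (hd k x).differentiableAt.differentiableWithinAt)) Metric.isOpen_ball
    (fun k x hx ↦ hle k x (Metric.ball_subset_closedBall hx)) (mem_ball_zero_iff.2 hzr)
  refine (this.mul_left z).congr_fun fun k ↦ ?_
  rw [(hd k z).deriv, hypTerm]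
  rcases k with _ | k
  · simp
  · rw [Nat.add_sub_cancel, pow_succ]
    ring

/-- The operator z d/dz + c sends F(a,b;c+1) to c F(a,b;c), because (c)ₖ (c+k) = c (c+1)ₖ. This
removes the condition re b < re c of Euler's integral. -/
theorem IsGaussContinuation.exists_of_add_one {a b c : ℂ} (hc : ∀ n : ℕ, c ≠ -(n : ℂ))
    (h : ∃ F, IsGaussContinuation a b (c + 1) F) : ∃ F, IsGaussContinuation a b c F := by
  obtain ⟨F, hF⟩ := h
  have hc0 : c ≠ 0 := by simpa using hc 0
  refine ⟨fun z ↦ (z * deriv F z + c * F z) / c, ?_, fun z hz ↦ ?_⟩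
  · exact ((analyticOnNhd_id.mul hF.1.deriv).add (analyticOnNhd_const.mul hF.1)).div
      analyticOnNhd_const fun _ _ ↦ hc0
  · have hev : F =ᶠ[𝓝 z] hypSum a b (c + 1) := by
      filter_upwards [(isOpen_lt continuous_norm continuous_const).mem_nhds hz] with x hx
      exact hF.eq_hypSum hx
    have h1 := hasSum_natCast_mul_hypTerm (a := a) (b := b) (add_one_ne_neg_natCast hc) hz
    rw [← hev.deriv_eq] at h1
    have h2 : HasSum (hypTerm a b (c + 1) z) (F z) := hF.2 z hz
    refine ((h1.add (h2.mul_left c)).div_const c).congr_fun fun k ↦ ?_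
    have hp := ascPochhammer_eval_succ_left c k
    rw [ascPochhammer_succ_eval] at hp
    have hck := ascPochhammer_eval_ne_zero hc k
    have hck' := ascPochhammer_eval_ne_zero (add_one_ne_neg_natCast hc) k
    have hk : (Nat.factorial k : ℂ) ≠ 0 := by exact_mod_cast k.factorial_ne_zero
    rw [hypTerm]
    field_simp
    linear_combination -(z ^ k * (ascPochhammer ℂ k).eval a * (ascPochhammer ℂ k).eval b) * hp

theorem hypTerm_add_one_eq {a b c : ℂ} (hc : ∀ n : ℕ, c ≠ -(n : ℂ)) (z : ℂ) (k : ℕ) :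
    hypTerm a b c z (k + 1) = a * b / c * z * (hypTerm (a + 1) (b + 1) (c + 1) z k / (k + 1)) := by
  have hc0 : c ≠ 0 := by simpa using hc 0
  have hck' := ascPochhammer_eval_ne_zero (add_one_ne_neg_natCast hc) k
  have hk : (Nat.factorial k : ℂ) ≠ 0 := by exact_mod_cast k.factorial_ne_zero
  have hk1 : (k : ℂ) + 1 ≠ 0 := by exact_mod_cast k.succ_ne_zero
  simp only [hypTerm, ascPochhammer_eval_succ_left, Nat.factorial_succ]
  push_cast
  field_simp
  ring

/-- Integrates F'(a,b;c) = (ab/c) F(a+1,b+1;c+1) along the segment from 0 to z, which stays in the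
star-shaped cut plane. This removes the condition re b > 0. -/
theorem IsGaussContinuation.exists_of_add_one_add_one {a b c : ℂ} (hc : ∀ n : ℕ, c ≠ -(n : ℂ))
    (h : ∃ F, IsGaussContinuation (a + 1) (b + 1) (c + 1) F) :
    ∃ F, IsGaussContinuation a b c F := by
  obtain ⟨F, hF⟩ := h
  have hmaps : Set.MapsTo (fun p : ℂ × ℝ ↦ p.1 * (p.2 : ℂ)) (cutPlane ×ˢ Set.Icc (0 : ℝ) 1)
      cutPlane := fun p hp ↦ mul_mem_cutPlane hp.1 hp.2
  refine ⟨fun z ↦ 1 + a * b / c * z * ∫ t in (0 : ℝ)..1, 1 * F (z * t), ?_, fun z hz ↦ ?_⟩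
  · refine DifferentiableOn.analyticOnNhd ?_ isOpen_cutPlane
    refine (differentiableOn_const 1).add (DifferentiableOn.mul (by fun_prop) ?_)
    refine differentiableOn_intervalIntegral_mul (g := fun _ ↦ 1) (by simp) isOpen_cutPlane
      (φ := fun z t ↦ F (z * t)) (φ' := fun z t ↦ deriv F (z * t) * t) ?_ ?_ ?_
    · exact hF.1.continuousOn.comp (by fun_prop) hmaps
    · exact (hF.1.deriv.continuousOn.comp (by fun_prop) hmaps).mul (by fun_prop)
    · intro z hz t ht
      have h1 : HasDerivAt (fun z : ℂ ↦ z * t) (t : ℂ) z := by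
        simpa using (hasDerivAt_id z).mul_const (t : ℂ)
      exact (hF.1 _ (mul_mem_cutPlane hz ht)).differentiableAt.hasDerivAt.comp z h1
  · have hterm : ∀ (k : ℕ) (t : ℝ), hypTerm (a + 1) (b + 1) (c + 1) (z * t) k =
        hypTerm (a + 1) (b + 1) (c + 1) z k * (t : ℂ) ^ k := fun k t ↦ by
      rw [hypTerm, hypTerm, mul_pow]; ring
    have key := hasSum_intervalIntegral_mul (g := fun _ ↦ 1) (by simp)
      (φ := fun k t ↦ hypTerm (a + 1) (b + 1) (c + 1) (z * t) k) (f := fun t ↦ F (z * t))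
      (summable_norm_hypTerm (a := a + 1) (b := b + 1) (add_one_ne_neg_natCast hc) hz) (fun n ↦ ?_) ?_ ?_
    · have h1 := (key.mul_left (a * b / c * z))
      refine ((hasSum_nat_add_iff' 1).1 ?_)
      simp only [Finset.sum_range_one, ascPochhammer_zero, Polynomial.eval_one, pow_zero,
        Nat.factorial_zero, Nat.cast_one, mul_one, div_one, add_sub_cancel_left]
      refine h1.congr_fun fun k ↦ ?_
      refine (hypTerm_add_one_eq hc z k).trans ?_
      congr 1
      simp only [hterm, one_mul]
      rw [intervalIntegral.integral_const_mul]
      have : ∫ t in (0 : ℝ)..1, (t : ℂ) ^ k = ((∫ t in (0 : ℝ)..1, t ^ k : ℝ) : ℂ) := by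
        rw [← intervalIntegral.integral_ofReal]
        simp
      rw [this, integral_pow]
      simp [div_eq_mul_inv]
    · simp only [hterm]
      fun_prop
    · intro n t ht
      have : ‖(t : ℂ)‖ ≤ 1 := by
        rw [Complex.norm_real, Real.norm_of_nonneg ht.1]; exact ht.2
      rw [hterm, norm_mul, norm_pow]
      exact mul_le_of_le_one_right (norm_nonneg _) (pow_le_one₀ (norm_nonneg _) this)
    · intro t ht
      refine hF.2 _ ?_
      rw [norm_mul, Complex.norm_real, Real.norm_of_nonneg ht.1.le]
      nlinarith [norm_nonneg z, ht.1, ht.2]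

theorem isGaussContinuation_eulerIntegral (a : ℂ) {b c : ℂ} (hb : 0 < b.re) (hbc : b.re < c.re) :
    IsGaussContinuation a b c
      fun z ↦ eulerIntegral a b (c - b) z / Complex.betaIntegral b (c - b) := by
  have hd : 0 < (c - b).re := by simpa using hbc
  refine ⟨?_, fun z hz ↦ ?_⟩
  · exact ((differentiableOn_eulerIntegral a hb hd).div_const _).analyticOnNhd isOpen_cutPlane
  · have := (hasSum_eulerIntegral a hb hd hz).div_const (Complex.betaIntegral b (c - b))
    simp only [mul_div_cancel_left₀ _ (betaIntegral_ne_zero hb hd), add_sub_cancel] at this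
    exact this

theorem IsGaussContinuation.exists_of_re_pos (a : ℂ) {b : ℂ} (hb : 0 < b.re) (m : ℕ) {c : ℂ}
    (hc : ∀ n : ℕ, c ≠ -(n : ℂ)) (hm : b.re < c.re + m) : ∃ F, IsGaussContinuation a b c F := by
  induction m generalizing c with
  | zero => exact ⟨_, isGaussContinuation_eulerIntegral a hb (by simpa using hm)⟩
  | succ m ih =>
    refine exists_of_add_one hc (ih (add_one_ne_neg_natCast hc) ?_)
    push_cast at hm
    simp only [Complex.add_re, Complex.one_re]
    linarith

theorem IsGaussContinuation.exists_of_lt (n : ℕ) (a : ℂ) {b c : ℂ} (hb : 0 < b.re + n)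
    (hc : ∀ n : ℕ, c ≠ -(n : ℂ)) : ∃ F, IsGaussContinuation a b c F := by
  induction n generalizing a b c with
  | zero =>
    obtain ⟨m, hm⟩ := exists_nat_gt (b.re - c.re)
    exact exists_of_re_pos a (by simpa using hb) m hc (by linarith)
  | succ n ih =>
    refine exists_of_add_one_add_one hc (ih _ ?_ (add_one_ne_neg_natCast hc))
    push_cast at hb
    simp only [Complex.add_re, Complex.one_re]
    linarith

theorem isGaussContinuation_gaussHyp (a b : ℂ) {c : ℂ} (hc : ∀ n : ℕ, c ≠ -(n : ℂ)) :
    IsGaussContinuation a b c (gaussHyp a b c) := by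
  obtain ⟨n, hn⟩ := exists_nat_gt (-b.re)
  have h := IsGaussContinuation.exists_of_lt n a (b := b) (by linarith) hc
  rw [gaussHyp, dif_pos h]
  exact h.choose_spec

/-! ### Pfaff's transformation and holomorphy in the parameters. -/

/-- Substitute t = 1 - u and factor 1 - y(1-u) = (1-y)(1 - (y/(y-1)) u). For real y ≤ 0 both factors
are nonnegative reals, so the complex power splits without a branch correction. -/
theorem eulerIntegral_reflect (a b d : ℂ) {y : ℝ} (hy : y ≤ 0) :
    eulerIntegral a b d y = (1 - (y : ℂ)) ^ (-a) * eulerIntegral a d b ((y : ℂ) / (y - 1)) := by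
  have hy1 : (y : ℂ) - 1 ≠ 0 := by
    have : y - 1 ≠ 0 := by linarith
    exact_mod_cast this
  have h := intervalIntegral.integral_comp_sub_left (a := 0) (b := 1) (fun t : ℝ ↦
    ((t : ℂ) ^ (b - 1) * (1 - (t : ℂ)) ^ (d - 1)) * (1 - (y : ℂ) * t) ^ (-a)) 1
  rw [sub_self, sub_zero] at h
  rw [eulerIntegral, ← h, eulerIntegral, ← intervalIntegral.integral_const_mul]
  refine intervalIntegral.integral_congr fun u hu ↦ ?_
  rw [Set.uIcc_of_le zero_le_one] at hu
  have hfac : 1 - (y : ℂ) * ((1 - u : ℝ) : ℂ) = ((1 - y : ℝ) : ℂ) * ((1 - y / (y - 1) * u : ℝ) : ℂ) := by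
    push_cast
    field_simp
    ring
  have hpos : 0 ≤ 1 - y / (y - 1) * u := by
    have : y / (y - 1) * u = -y * u / (1 - y) := by
      rw [← neg_sub 1 y, div_neg]
      ring
    rw [this, sub_nonneg, div_le_one (by linarith)]
    nlinarith [hu.1, hu.2]
  rw [hfac, Complex.mul_cpow_ofReal_nonneg (by linarith) hpos]
  push_cast
  rw [sub_sub_cancel]
  ring

theorem norm_div_sub_one_lt_one {z : ℂ} (hz : z.re < 1 / 2) : ‖z / (z - 1)‖ < 1 := by
  have h1 : z - 1 ≠ 0 := fun h ↦ by
    have := congrArg Complex.re h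
    simp at this
    linarith
  rw [norm_div, div_lt_one (norm_pos_iff.2 h1), ← sq_lt_sq₀ (norm_nonneg _) (norm_nonneg _),
    Complex.sq_norm, Complex.sq_norm, Complex.normSq_apply, Complex.normSq_apply]
  simp
  nlinarith

theorem hypSum_pfaff_of_re_pos (a : ℂ) {b c : ℂ} (hb : 0 < b.re) (hd : b.re < c.re) {y : ℝ}
    (hy : y ≤ 0) (hy1 : -1 < y) :
    hypSum a b c y = (1 - (y : ℂ)) ^ (-a) * hypSum a (c - b) c ((y : ℂ) / (y - 1)) := by
  have hd' : 0 < (c - b).re := by simpa using hd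
  have hyn : ‖(y : ℂ)‖ < 1 := by
    rw [Complex.norm_real, Real.norm_eq_abs, abs_lt]
    constructor <;> linarith
  have h := eulerIntegral_reflect a b (c - b) hy
  rw [eulerIntegral_eq a hb hd' hyn, eulerIntegral_eq a hd' hb
    (norm_div_sub_one_lt_one (by simp; linarith)), Complex.betaIntegral_symm, add_sub_cancel,
    sub_add_cancel] at h
  have h0 := betaIntegral_ne_zero hd' hb
  refine mul_left_cancel₀ h0 (h.trans (by ring))

/-- The parameters `c` at which the hypergeometric series is defined. -/
def nonpolar : Set ℂ := {c | ∀ n : ℕ, c ≠ -(n : ℂ)}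

theorem isOpen_nonpolar : IsOpen nonpolar := by
  have : nonpolar = {c | (Complex.Gamma c)⁻¹ ≠ 0} := by
    ext c
    simp [nonpolar, Complex.Gamma_eq_zero_iff]
  rw [this]
  exact isOpen_ne_fun Complex.differentiable_one_div_Gamma.continuous continuous_const

theorem isPreconnected_nonpolar : IsPreconnected nonpolar := by
  have : nonpolar = (Set.range fun n : ℕ ↦ -(n : ℂ))ᶜ := by
    ext c
    simp [nonpolar, eq_comm]
  rw [this]
  exact ((Set.countable_range _).isConnected_compl_of_one_lt_rank (by simp)).isPreconnected

theorem eqOn_of_differentiableOn_of_eventuallyEq {f g : ℂ → ℂ} {U : Set ℂ} (hU : IsOpen U)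
    (hU' : IsPreconnected U) (hf : DifferentiableOn ℂ f U) (hg : DifferentiableOn ℂ g U) {z₀ : ℂ}
    (hz₀ : z₀ ∈ U) (h : f =ᶠ[𝓝 z₀] g) : Set.EqOn f g U :=
  (hf.analyticOnNhd hU).eqOn_of_preconnected_of_eventuallyEq (hg.analyticOnNhd hU) hU' hz₀ h

/-- An identity between functions of `(a, c)`, holomorphic in each variable for `c` off the
nonpositive integers, propagates from a region `0 < re a < re c - r`. -/
theorem eq_of_holomorphic_params {f g : ℂ → ℂ → ℂ} (r : ℝ) (hr : 0 ≤ r)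
    (hfa : ∀ c ∈ nonpolar, Differentiable ℂ fun a ↦ f a c)
    (hga : ∀ c ∈ nonpolar, Differentiable ℂ fun a ↦ g a c)
    (hfc : ∀ a, DifferentiableOn ℂ (f a) nonpolar) (hgc : ∀ a, DifferentiableOn ℂ (g a) nonpolar)
    (h : ∀ a c : ℂ, 0 < a.re → a.re + r < c.re → f a c = g a c) (a c : ℂ) (hc : c ∈ nonpolar) :
    f a c = g a c := by
  -- With c fixed and re c > r, the strip 0 < re a < re c - r is open and nonempty; the base point
  -- lies on its middle line.
  have step : ∀ c : ℂ, r < c.re → f a c = g a c := fun c hc ↦ by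
    have hcn : c ∈ nonpolar := ne_neg_natCast_of_re_pos (hr.trans_lt hc)
    refine eqOn_of_differentiableOn_of_eventuallyEq isOpen_univ isPreconnected_univ
      (hfa c hcn).differentiableOn (hga c hcn).differentiableOn
      (z₀ := (((c.re - r) / 2 : ℝ) : ℂ)) trivial ?_ (Set.mem_univ a)
    have h1 : ∀ᶠ x : ℂ in 𝓝 (((c.re - r) / 2 : ℝ) : ℂ), 0 < x.re :=
      (isOpen_lt continuous_const Complex.continuous_re).mem_nhds
        (by simp only [Set.mem_ofPred_eq, Complex.ofReal_re]; linarith)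
    have h2 : ∀ᶠ x : ℂ in 𝓝 (((c.re - r) / 2 : ℝ) : ℂ), x.re < c.re - r :=
      (isOpen_lt Complex.continuous_re continuous_const).mem_nhds
        (by simp only [Set.mem_ofPred_eq, Complex.ofReal_re]; linarith)
    filter_upwards [h1, h2] with x hx1 hx2 using h x c hx1 (by linarith)
  -- Now a is fixed and arbitrary, and the identity holds on the half-plane re c > r.
  refine eqOn_of_differentiableOn_of_eventuallyEq isOpen_nonpolar isPreconnected_nonpolar
    (hfc a) (hgc a) (z₀ := ((r + 1 : ℝ) : ℂ))
    (ne_neg_natCast_of_re_pos (by simp only [Complex.ofReal_re]; linarith)) ?_ hc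
  have h1 : ∀ᶠ x : ℂ in 𝓝 ((r + 1 : ℝ) : ℂ), r < x.re :=
    (isOpen_lt continuous_const Complex.continuous_re).mem_nhds
      (by simp only [Set.mem_ofPred_eq, Complex.ofReal_re]; linarith)
  filter_upwards [h1] with x hx using step x hx

/-- The Pfaff-transformed series `(1 - z)^(-a) ₂F₁(a, c - a; c; z / (z - 1))`. -/
noncomputable def pfaffSum (z a c : ℂ) : ℂ :=
  (1 - z) ^ (-a) * hypSum a (c - a) c (z / (z - 1))

theorem one_sub_ne_zero_of_re_lt {z : ℂ} (hz : z.re < 1 / 2) : 1 - z ≠ 0 := fun h ↦ by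
  have := congrArg Complex.re h
  simp at this
  linarith

theorem differentiable_pfaffSum_left {z : ℂ} (hz : z.re < 1 / 2) {c : ℂ} (hc : c ∈ nonpolar) :
    Differentiable ℂ fun a ↦ pfaffSum z a c := by
  refine Differentiable.mul (fun a ↦ ?_) (differentiableOn_univ.1 (differentiableOn_hypSum
    isOpen_univ (by fun_prop) (by fun_prop) (by fun_prop) (by fun_prop) (fun _ _ ↦ hc)
    (fun _ _ ↦ norm_div_sub_one_lt_one hz)))
  exact differentiableAt_id.neg.const_cpow (Or.inl (one_sub_ne_zero_of_re_lt hz))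

theorem differentiableOn_pfaffSum_right {z : ℂ} (hz : z.re < 1 / 2) (a : ℂ) :
    DifferentiableOn ℂ (pfaffSum z a) nonpolar :=
  (differentiableOn_const _).mul (differentiableOn_hypSum isOpen_nonpolar (by fun_prop)
    (by fun_prop) (by fun_prop) (by fun_prop) (fun _ hx ↦ hx)
    (fun _ _ ↦ norm_div_sub_one_lt_one hz))

theorem hypSum_eq_pfaffSum (a c : ℂ) (hc : c ∈ nonpolar) {y : ℝ} (hy : y ≤ 0) (hy1 : -1 < y) :
    hypSum a a c y = pfaffSum y a c := by
  have hyn : ‖(y : ℂ)‖ < 1 := by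
    rw [Complex.norm_real, Real.norm_eq_abs, abs_lt]
    constructor <;> linarith
  have hyr : (y : ℂ).re < 1 / 2 := by simp; linarith
  refine eq_of_holomorphic_params (f := fun a c ↦ hypSum a a c y) (g := pfaffSum y) 0 le_rfl
    ?_ ?_ ?_ ?_ ?_ a c hc
  · exact fun c hc ↦ differentiableOn_univ.1 (differentiableOn_hypSum isOpen_univ (by fun_prop)
      (by fun_prop) (by fun_prop) (by fun_prop) (fun _ _ ↦ hc) (fun _ _ ↦ hyn))
  · exact fun c hc ↦ differentiable_pfaffSum_left hyr hc
  · exact fun a ↦ differentiableOn_hypSum isOpen_nonpolar (by fun_prop)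
      (by fun_prop) (by fun_prop) (by fun_prop) (fun _ hx ↦ hx) (fun _ _ ↦ hyn)
  · exact fun a ↦ differentiableOn_pfaffSum_right hyr a
  · exact fun a c ha hac ↦ hypSum_pfaff_of_re_pos a ha (by linarith) hy hy1

/-- `gaussHyp` is chosen separately for each (a, c), which hides its dependence on them. On re z <
1/2 one has |z/(z-1)| < 1, so the Pfaff series shows that it is holomorphic in a and in c. -/
theorem gaussHyp_eq_pfaffSum (a c : ℂ) (hc : c ∈ nonpolar) {z : ℂ} (hz : z.re < 1 / 2) :
    gaussHyp a a c z = pfaffSum z a c := by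
  have hF := isGaussContinuation_gaussHyp a a hc
  have hUo : IsOpen {z : ℂ | z.re < 1 / 2} := isOpen_lt Complex.continuous_re continuous_const
  have hsub : {z : ℂ | z.re < 1 / 2} ⊆ cutPlane := by
    rintro _ hw x hx rfl
    simp only [Set.mem_ofPred_eq, Complex.ofReal_re] at hw
    linarith
  have hG : DifferentiableOn ℂ (fun z ↦ pfaffSum z a c) {z : ℂ | z.re < 1 / 2} := by
    refine DifferentiableOn.mul (DifferentiableOn.cpow (by fun_prop) (by fun_prop) fun w hw ↦
      one_sub_mem_slitPlane (hsub hw)) (differentiableOn_hypSum hUo (by fun_prop) (by fun_prop)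
      (by fun_prop) (DifferentiableOn.div (by fun_prop) (by fun_prop) fun w hw h ↦ ?_)
      (fun _ _ ↦ hc) (fun w hw ↦ norm_div_sub_one_lt_one hw))
    exact one_sub_ne_zero_of_re_lt hw (by linear_combination -h)
  refine (hF.1.mono hsub).eqOn_of_preconnected_of_frequently_eq (hG.analyticOnNhd hUo)
    (convex_halfSpace_re_lt _).isPreconnected (z₀ := 0) (by simp) ?_ hz
  -- Agreement is known only on the real interval (-1, 0]; the points -1/(n+2) in it accumulate at
  -- 0, which suffices for the identity theorem.
  have hseq : Tendsto (fun n : ℕ ↦ ((-(1 / ((n : ℝ) + 2)) : ℝ) : ℂ)) atTop (𝓝[≠] 0) := by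
    rw [tendsto_nhdsWithin_iff]
    constructor
    · have h1 : Tendsto (fun n : ℕ ↦ -(1 / ((n : ℝ) + 2))) atTop (𝓝 (-0)) :=
        (tendsto_const_nhds.div_atTop
          (tendsto_atTop_add_const_right _ _ tendsto_natCast_atTop_atTop)).neg
      rw [neg_zero] at h1
      exact_mod_cast (Complex.continuous_ofReal.tendsto 0).comp h1
    · refine Eventually.of_forall fun n ↦ ?_
      have : -(1 / ((n : ℝ) + 2)) ≠ 0 := by
        have : 0 < 1 / ((n : ℝ) + 2) := by positivity
        linarith
      exact Complex.ofReal_ne_zero.2 this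
  refine hseq.frequently (Frequently.of_forall fun n ↦ ?_)
  have hpos : 0 < 1 / ((n : ℝ) + 2) := by positivity
  have hlt : 1 / ((n : ℝ) + 2) < 1 := by
    rw [div_lt_one (by positivity)]
    linarith [(Nat.cast_nonneg n : (0 : ℝ) ≤ n)]
  rw [← hypSum_eq_pfaffSum a c hc (by linarith) (by linarith)]
  refine hF.eq_hypSum ?_
  rw [Complex.norm_real, Real.norm_eq_abs, abs_lt]
  constructor <;> linarith

/-! ### Two-term expansion of Euler's integral when a - b is not an integer. -/

theorem ascPochhammer_eval_eq_prod (s : ℂ) (n : ℕ) :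
    (ascPochhammer ℂ n).eval s = ∏ j ∈ Finset.range n, (s + j) := by
  induction n with
  | zero => simp
  | succ n ih => rw [ascPochhammer_succ_eval, Finset.prod_range_succ, ih]

theorem binCoef_succ_eq (s : ℂ) {n : ℕ} (hn : n ≠ 0) :
    binCoef s (n + 1) = (n : ℂ) ^ s / (n + 1) * (Complex.GammaSeq s n)⁻¹ := by
  have hn0 : (n : ℂ) ≠ 0 := by exact_mod_cast hn
  have h1 : (n : ℂ) ^ s ≠ 0 := fun h ↦ hn0 ((Complex.cpow_eq_zero_iff _ _).1 h).1
  have h2 : (Nat.factorial n : ℂ) ≠ 0 := by exact_mod_cast n.factorial_ne_zero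
  have h3 : (n : ℂ) + 1 ≠ 0 := by exact_mod_cast n.succ_ne_zero
  rw [binCoef, ascPochhammer_eval_eq_prod, Complex.GammaSeq, Nat.factorial_succ, inv_div]
  push_cast
  field_simp

theorem tendsto_inv_GammaSeq (s : ℂ) :
    Tendsto (fun n ↦ (Complex.GammaSeq s n)⁻¹) atTop (𝓝 (Complex.Gamma s)⁻¹) := by
  by_cases h : Complex.Gamma s = 0
  · obtain ⟨m, rfl⟩ := (Complex.Gamma_eq_zero_iff s).1 h
    rw [h, inv_zero]
    -- At a pole the product in `GammaSeq` contains a zero factor once n ≥ m, and division by zero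
    -- gives the constant value 0.
    refine tendsto_const_nhds.congr' ?_
    filter_upwards [eventually_ge_atTop m] with n hn
    rw [Complex.GammaSeq, Finset.prod_eq_zero (Finset.mem_range.2 (Nat.lt_succ_of_le hn)) (by simp)]
    simp
  · exact (Complex.GammaSeq_tendsto_Gamma s).inv₀ h

/-- Gauss's product gives coefficients of size O(n^(re s - 1)). With s = 1 - d this is where re d >
1 enters: the series of (1-t)^(d-1) then converges absolutely up to t = 1. -/
theorem summable_norm_binCoef {s : ℂ} (hs : s.re < 0) : Summable fun n ↦ ‖binCoef s n‖ := by
  rw [← summable_nat_add_iff 1]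
  refine summable_of_isBigO_nat (Real.summable_nat_rpow.2 (show s.re - 1 < -1 by linarith)) ?_
  have h1 := (tendsto_inv_GammaSeq s).isBigO_one ℝ
  have h2 : (fun n : ℕ ↦ (n : ℂ) ^ s / (n + 1)) =O[atTop] fun n : ℕ ↦ (n : ℝ) ^ (s.re - 1) := by
    refine Asymptotics.IsBigO.of_bound 1 ?_
    filter_upwards [eventually_gt_atTop 0] with n hn
    have hn' : (0 : ℝ) < n := by exact_mod_cast hn
    have h4 : ‖(n : ℂ) + 1‖ = (n : ℝ) + 1 := by exact_mod_cast Complex.norm_natCast (n + 1)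
    rw [norm_div, h4, Complex.norm_natCast_cpow_of_pos hn, Real.norm_of_nonneg (by positivity),
      Real.rpow_sub_one hn'.ne', one_mul]
    gcongr
    linarith
  refine (Asymptotics.IsBigO.congr' (h2.mul h1) ?_ ?_).norm_left
  · filter_upwards [eventually_gt_atTop 0] with n hn
    exact (binCoef_succ_eq s hn.ne').symm
  · exact Eventually.of_forall fun n ↦ by simp

/-- The integral `∫₀¹ t^(q-1) (1+σt)^(-a) dt`. -/
noncomputable def powIntegral (σ : ℝ) (a q : ℂ) : ℂ :=
  ∫ t in (0 : ℝ)..1, (t : ℂ) ^ (q - 1) * (1 + (σ : ℂ) * t) ^ (-a)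

theorem one_add_mul_mem_slitPlane {σ t : ℝ} (hσ : 0 ≤ σ) (ht : 0 ≤ t) :
    1 + (σ : ℂ) * t ∈ Complex.slitPlane := by
  have : 0 < 1 + σ * t := by positivity
  exact_mod_cast Complex.ofReal_mem_slitPlane.2 this

theorem intervalIntegrable_cpow_mul {q : ℂ} (hq : 0 < q.re) {σ : ℝ} (hσ : 0 ≤ σ) (a : ℂ) :
    IntervalIntegrable (fun t : ℝ ↦ (t : ℂ) ^ (q - 1) * (1 + (σ : ℂ) * t) ^ (-a))
      MeasureTheory.volume 0 1 := by
  refine (intervalIntegral.intervalIntegrable_cpow' (by simpa using hq)).mul_continuousOn ?_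
  rw [Set.uIcc_of_le zero_le_one]
  exact ContinuousOn.cpow (by fun_prop) (by fun_prop) fun t ht ↦
    one_add_mul_mem_slitPlane hσ ht.1

/-- Integrate the derivative of t^q (1+σt)^(1-a) over [0, 1]; the boundary term at 0 vanishes
because re q > 0. -/
theorem powIntegral_recurrence {q : ℂ} (hq : 0 < q.re) {σ : ℝ} (hσ : 0 ≤ σ) (a : ℂ) :
    q * powIntegral σ a q + σ * (q + 1 - a) * powIntegral σ a (q + 1) = (1 + (σ : ℂ)) ^ (1 - a) := by
  have hq1 : 0 < (q + 1).re := by simp; linarith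
  have hq0 : q ≠ 0 := fun h ↦ by simp [h] at hq
  have hi1 := (intervalIntegrable_cpow_mul hq hσ a).const_mul q
  have hi2 := (intervalIntegrable_cpow_mul hq1 hσ a).const_mul (σ * (q + 1 - a))
  have := intervalIntegral.integral_eq_sub_of_hasDerivAt_of_le zero_le_one
    (f := fun t : ℝ ↦ (t : ℂ) ^ q * (1 + (σ : ℂ) * t) ^ (1 - a)) ?_ ?_ (hi1.add hi2)
  · rw [intervalIntegral.integral_add hi1 hi2, intervalIntegral.integral_const_mul,
      intervalIntegral.integral_const_mul] at this
    rw [powIntegral, powIntegral, this]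
    simp [hq0]
  · refine ContinuousOn.mul (fun t ht ↦ ?_) (ContinuousOn.cpow (by fun_prop) (by fun_prop) fun t ht ↦
      one_add_mul_mem_slitPlane hσ ht.1)
    exact ((Complex.continuousAt_cpow_const_of_re_pos (Or.inl (by simpa using ht.1)) hq).comp
      Complex.continuous_ofReal.continuousAt).continuousWithinAt
  · intro t ht
    have ht0 : (t : ℂ) ≠ 0 := by exact_mod_cast ht.1.ne'
    have hsl := one_add_mul_mem_slitPlane hσ ht.1.le
    have h1 : HasDerivAt (fun t : ℂ ↦ t ^ q) (q * (t : ℂ) ^ (q - 1)) t := by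
      simpa using (hasDerivAt_id (t : ℂ)).cpow_const (c := q) (Or.inl (by simpa using ht.1))
    have h2 : HasDerivAt (fun t : ℂ ↦ 1 + (σ : ℂ) * t) (σ : ℂ) t := by
      simpa using ((hasDerivAt_id (t : ℂ)).const_mul (σ : ℂ)).const_add 1
    refine ((h1.mul (h2.cpow_const (c := 1 - a) hsl)).comp_ofReal).congr_deriv ?_
    have e1 : (1 + (σ : ℂ) * t) ^ (1 - a) = (1 + (σ : ℂ) * t) * (1 + (σ : ℂ) * t) ^ (-a) := by
      rw [sub_eq_add_neg, Complex.cpow_add _ _ (Complex.slitPlane_ne_zero hsl), Complex.cpow_one]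
    have e2 : (t : ℂ) ^ q = t * (t : ℂ) ^ (q - 1) := by
      rw [Complex.cpow_sub _ _ ht0, Complex.cpow_one]
      field_simp
    rw [add_sub_cancel_right, e1, show (1 - a - 1 : ℂ) = -a by ring, e2]
    ring

/-- Substitution x = σt/(1+σt), for which 1 - x = 1/(1+σt). -/
theorem intervalIntegral_beta_eq {p r : ℂ} (hp : 0 < p.re) (hr : 0 < r.re) {σ : ℝ} (hσ : 0 < σ) :
    ∫ x in (0 : ℝ)..σ / (1 + σ), (x : ℂ) ^ (p - 1) * (1 - (x : ℂ)) ^ (r - 1) =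
      (σ : ℂ) ^ p * powIntegral σ (p + r) p := by
  have hpos : ∀ t ∈ Set.Icc (0 : ℝ) 1, 0 < 1 + σ * t := fun t ht ↦ by nlinarith [ht.1]
  have heq : ∀ t ∈ Set.Icc (0 : ℝ) 1, (σ / (1 + σ * t) ^ 2) •
      ((fun x : ℝ ↦ (x : ℂ) ^ (p - 1) * (1 - (x : ℂ)) ^ (r - 1)) ∘ fun t ↦ σ * t / (1 + σ * t)) t =
      (σ : ℂ) ^ p * ((t : ℂ) ^ (p - 1) * (1 + (σ : ℂ) * t) ^ (-(p + r))) := by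
    intro t ht
    have h := hpos t ht
    have hne : ((1 + σ * t : ℝ) : ℂ) ≠ 0 := by exact_mod_cast h.ne'
    have hσ0 : (σ : ℂ) ≠ 0 := by exact_mod_cast hσ.ne'
    have h1 : ((σ * t / (1 + σ * t) : ℝ) : ℂ) = (σ : ℂ) * ((t * (1 + σ * t)⁻¹ : ℝ) : ℂ) := by
      push_cast; ring
    have h2 : 1 - ((σ * t / (1 + σ * t) : ℝ) : ℂ) = ((1 + σ * t)⁻¹ : ℝ) := by
      push_cast at hne ⊢
      field_simp
      ring
    have hinv : ∀ e : ℂ, (((1 + σ * t)⁻¹ : ℝ) : ℂ) ^ e = ((1 + σ * t : ℝ) : ℂ) ^ (-e) := fun e ↦ by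
      rw [Complex.ofReal_inv, Complex.inv_cpow _ _ (by
        rw [Complex.arg_ofReal_of_nonneg h.le]; exact Real.pi_pos.ne), Complex.cpow_neg]
    have hc : (1 + (σ : ℂ) * t) = ((1 + σ * t : ℝ) : ℂ) := by push_cast; rfl
    have hinv0 : 0 ≤ (1 + σ * t)⁻¹ := (inv_pos.2 h).le
    simp only [Function.comp, Complex.real_smul]
    rw [h2, h1, Complex.mul_cpow_ofReal_nonneg hσ.le (mul_nonneg ht.1 hinv0), Complex.ofReal_mul,
      Complex.mul_cpow_ofReal_nonneg ht.1 hinv0, hinv, hinv, hc,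
      show -(p + r) = -(p - 1) + -(r - 1) + -2 by ring, Complex.cpow_add _ _ hne,
      Complex.cpow_add _ _ hne, Complex.cpow_neg _ 2, Complex.cpow_ofNat, Complex.cpow_sub _ _ hσ0,
      Complex.cpow_one]
    push_cast
    field_simp
  have hx1 : σ / (1 + σ) < 1 := by rw [div_lt_one (by linarith)]; linarith
  have hx0 : 0 ≤ σ / (1 + σ) := by positivity
  have hcont : ContinuousOn (fun t : ℝ ↦ σ * t / (1 + σ * t)) (Set.uIcc 0 1) := by
    rw [Set.uIcc_of_le zero_le_one]
    exact ContinuousOn.div (by fun_prop) (by fun_prop) fun t ht ↦ (hpos t ht).ne'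
  have himg : (fun t : ℝ ↦ σ * t / (1 + σ * t)) '' Set.uIcc 0 1 ⊆ Set.Icc 0 (σ / (1 + σ)) := by
    rw [Set.uIcc_of_le zero_le_one]
    rintro _ ⟨t, ht, rfl⟩
    have := hpos t ht
    refine ⟨div_nonneg (mul_nonneg hσ.le ht.1) this.le, ?_⟩
    rw [div_le_div_iff₀ this (by linarith)]
    nlinarith [ht.2]
  have himg' : (fun t : ℝ ↦ σ * t / (1 + σ * t)) '' Set.Ioo (min 0 1) (max 0 1) ⊆ Set.Ioo 0 1 := by
    rw [min_eq_left zero_le_one, max_eq_right zero_le_one]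
    rintro _ ⟨t, ht, rfl⟩
    have := hpos t (Set.Ioo_subset_Icc_self ht)
    refine ⟨div_pos (mul_pos hσ ht.1) this, ?_⟩
    rw [div_lt_one this]
    linarith
  have hbeta := Complex.betaIntegral_convergent hp hr
  rw [intervalIntegrable_iff_integrableOn_Icc_of_le zero_le_one] at hbeta
  have key := intervalIntegral.integral_deriv_smul_comp''' (a := 0) (b := 1)
    (f := fun t : ℝ ↦ σ * t / (1 + σ * t)) (f' := fun t ↦ σ / (1 + σ * t) ^ 2)
    (g := fun x : ℝ ↦ (x : ℂ) ^ (p - 1) * (1 - (x : ℂ)) ^ (r - 1)) hcont ?_ ?_ ?_ ?_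
  · rw [mul_zero, zero_div, mul_one] at key
    rw [← key, powIntegral, ← intervalIntegral.integral_const_mul]
    refine intervalIntegral.integral_congr fun t ht ↦ ?_
    rw [Set.uIcc_of_le zero_le_one] at ht
    exact heq t ht
  · intro t ht
    rw [min_eq_left zero_le_one, max_eq_right zero_le_one] at ht
    have h := hpos t (Set.Ioo_subset_Icc_self ht)
    have h1 : HasDerivAt (fun t : ℝ ↦ σ * t) σ t := by
      simpa using (hasDerivAt_id t).const_mul σ
    refine ((h1.div (h1.const_add 1) h.ne').congr_deriv ?_).hasDerivWithinAt
    field_simp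
    ring
  · refine ContinuousOn.mono (fun x hx ↦ ContinuousAt.continuousWithinAt ?_) himg'
    refine ContinuousAt.mul (ContinuousAt.cpow (by fun_prop) (by fun_prop) ?_)
      (ContinuousAt.cpow (by fun_prop) (by fun_prop) ?_)
    · exact Complex.ofReal_mem_slitPlane.2 hx.1
    · have : 0 < 1 - x := by linarith [hx.2]
      exact_mod_cast Complex.ofReal_mem_slitPlane.2 this
  · exact hbeta.mono_set (himg.trans (Set.Icc_subset_Icc_right hx1.le))
  · rw [Set.uIcc_of_le zero_le_one]
    have h := (intervalIntegrable_cpow_mul hp hσ.le (p + r)).const_mul ((σ : ℂ) ^ p)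
    rw [intervalIntegrable_iff_integrableOn_Icc_of_le zero_le_one] at h
    exact h.congr_fun (fun t ht ↦ (heq t ht).symm) measurableSet_Icc

/-- This is ∫₀^∞ t^(q-1) (1+st)^(-a) dt cut at t = 1. In beta form the cut is at s/(1+s), and x ↦ 1
- x turns the upper piece into an incomplete beta integral with s⁻¹ in place of s. -/
theorem powIntegral_add_powIntegral_inv {a q : ℂ} (hq : 0 < q.re) (hqa : q.re < a.re) {s : ℝ}
    (hs : 0 < s) : powIntegral s a q + (s : ℂ) ^ (-a) * powIntegral s⁻¹ a (a - q) =
      (s : ℂ) ^ (-q) * Complex.betaIntegral q (a - q) := by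
  have hr : 0 < (a - q).re := by simpa using hqa
  have hs0 : (s : ℂ) ≠ 0 := by exact_mod_cast hs.ne'
  have h1 := intervalIntegral_beta_eq hq hr hs
  have h2 := intervalIntegral_beta_eq hr hq (inv_pos.2 hs)
  have h3 := intervalIntegral.integral_comp_sub_left (a := 0) (b := s⁻¹ / (1 + s⁻¹)) (fun x : ℝ ↦
    (x : ℂ) ^ (q - 1) * (1 - (x : ℂ)) ^ (a - q - 1)) 1
  have hx : 1 - s⁻¹ / (1 + s⁻¹) = s / (1 + s) := by field_simp; ring
  rw [hx, sub_zero] at h3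
  have h4 : ∫ x in s / (1 + s)..1, (x : ℂ) ^ (q - 1) * (1 - (x : ℂ)) ^ (a - q - 1) =
      ((s⁻¹ : ℝ) : ℂ) ^ (a - q) * powIntegral s⁻¹ (a - q + q) (a - q) := by
    rw [← h3, ← h2]
    refine intervalIntegral.integral_congr fun x _ ↦ ?_
    push_cast
    rw [sub_sub_cancel, mul_comm]
  have hbeta := Complex.betaIntegral_convergent hq hr
  have hx0 : 0 ≤ s / (1 + s) := by positivity
  have hx1 : s / (1 + s) ≤ 1 := by rw [div_le_one (by linarith)]; linarith
  have h5 := intervalIntegral.integral_add_adjacent_intervals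
    (hbeta.mono_set (c := 0) (d := s / (1 + s)) (by
      rw [Set.uIcc_of_le hx0, Set.uIcc_of_le zero_le_one]; exact Set.Icc_subset_Icc_right hx1))
    (hbeta.mono_set (c := s / (1 + s)) (d := 1) (by
      rw [Set.uIcc_of_le hx1, Set.uIcc_of_le zero_le_one]; exact Set.Icc_subset_Icc_left hx0))
  rw [h1, h4, ← Complex.betaIntegral, add_sub_cancel, sub_add_cancel, Complex.ofReal_inv,
    Complex.inv_cpow _ _ (by
      rw [Complex.arg_ofReal_of_nonneg hs.le]; exact Real.pi_pos.ne), ← Complex.cpow_neg, neg_sub] at h5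
  rw [← h5, mul_add, ← mul_assoc, ← mul_assoc, ← Complex.cpow_add _ _ hs0,
    ← Complex.cpow_add _ _ hs0, neg_add_cancel, Complex.cpow_zero, one_mul]
  congr 3
  ring

theorem hasSum_div_add_natCast {p : ℂ} (hp : 0 < p.re) {e : ℕ → ℂ} (he : Summable fun k ↦ ‖e k‖)
    {f : ℝ → ℂ} (hf : ∀ t ∈ Set.Ioo (0 : ℝ) 1, HasSum (fun k ↦ e k * (t : ℂ) ^ k) (f t)) :
    HasSum (fun k ↦ e k / (p + k)) (∫ t in (0 : ℝ)..1, (t : ℂ) ^ (p - 1) * f t) := by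
  have key := hasSum_intervalIntegral_mul
    (intervalIntegral.intervalIntegrable_cpow' (r := p - 1) (by simpa using hp))
    (φ := fun k t ↦ e k * (t : ℂ) ^ k) he (fun k ↦ by fun_prop) (fun k t ht ↦ ?_) hf
  · refine key.congr_fun fun k ↦ ?_
    have hpk : 0 < (p + k).re := by
      simp only [Complex.add_re, Complex.natCast_re]
      positivity
    have hpk0 : p + k ≠ 0 := fun h ↦ by simp [h] at hpk
    have : ∀ t ∈ Set.uIoc (0 : ℝ) 1, (t : ℂ) ^ (p - 1) * (e k * (t : ℂ) ^ k) =
        e k * (t : ℂ) ^ (p + k - 1) := by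
      intro t ht
      rw [Set.uIoc_of_le zero_le_one] at ht
      have ht0 : (t : ℂ) ≠ 0 := by exact_mod_cast ht.1.ne'
      rw [add_sub_right_comm, Complex.cpow_add _ _ ht0, Complex.cpow_natCast]
      ring
    rw [intervalIntegral.integral_congr_ae (MeasureTheory.ae_of_all _ this),
      intervalIntegral.integral_const_mul, integral_cpow (Or.inl (by
        rw [Complex.sub_re, Complex.one_re]
        linarith))]
    simp [hpk0, div_eq_mul_inv]
  · have : ‖(t : ℂ)‖ ≤ 1 := by
      rw [Complex.norm_real, Real.norm_of_nonneg ht.1]; exact ht.2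
    rw [norm_mul, norm_pow]
    exact mul_le_of_le_one_right (norm_nonneg _) (pow_le_one₀ (norm_nonneg _) this)

/-- Write k eₖ/(z+k) = eₖ - z eₖ/(z+k), then shift the index and use the recurrence of e. It
replaces integration by parts where re z ≤ 0 and the integral diverges; it serves with l = -s⁻¹ and
with l = 1. -/
theorem partialFraction_recurrence {e : ℕ → ℂ} {l α z S W W' : ℂ}
    (he : ∀ k : ℕ, ((k : ℂ) + 1) * e (k + 1) = l * (α + k) * e k) (hz : ∀ k : ℕ, z + k ≠ 0)
    (hS : HasSum e S) (hW : HasSum (fun k ↦ e k / (z + k)) W)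
    (hW' : HasSum (fun k ↦ e k / (z + 1 + k)) W') :
    S - z * W = l * (S + (α - z - 1) * W') := by
  have h1 : HasSum (fun k : ℕ ↦ k * e k / (z + k)) (S - z * W) := by
    refine (hS.sub (hW.mul_left z)).congr_fun fun k ↦ ?_
    have := hz k
    field_simp
    ring
  have h2 : HasSum (fun k : ℕ ↦ ((k + 1 : ℕ) : ℂ) * e (k + 1) / (z + (k + 1 : ℕ)))
      (l * (S + (α - z - 1) * W')) := by
    refine ((hS.add (hW'.mul_left (α - z - 1))).mul_left l).congr_fun fun k ↦ ?_
    have := hz (k + 1)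
    push_cast at this ⊢
    have h3 : z + 1 + k ≠ 0 := by convert this using 1; ring
    rw [he, show z + ((k : ℂ) + 1) = z + 1 + k by ring]
    field_simp
    ring
  have h3 := (hasSum_nat_add_iff' (f := fun k : ℕ ↦ (k : ℂ) * e k / (z + k)) 1).2 h1
  simp only [Finset.sum_range_one, Nat.cast_zero, zero_mul, zero_div, sub_zero] at h3
  exact h3.unique h2

/-- `Γ(p) Γ(q) / Γ(p + q)`, the meromorphic continuation of the beta integral. -/
noncomputable def gammaBeta (p q : ℂ) : ℂ :=
  Complex.Gamma p * Complex.Gamma q * (Complex.Gamma (p + q))⁻¹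

theorem betaIntegral_eq_gammaBeta {p q : ℂ} (hp : 0 < p.re) (hq : 0 < q.re) :
    Complex.betaIntegral p q = gammaBeta p q := by
  rw [gammaBeta, Complex.betaIntegral_eq_Gamma_mul_div _ _ hp hq, div_eq_mul_inv]

theorem mul_gammaBeta {p q : ℂ} (hp : p ≠ 0) :
    p * gammaBeta p q = (p + q) * gammaBeta (p + 1) q := by
  rw [gammaBeta, gammaBeta, Complex.Gamma_add_one _ hp,
    Complex.one_div_Gamma_eq_self_mul_one_div_Gamma_add_one (p + q), add_right_comm]
  ring

theorem mul_gammaBeta_sub_one {p q : ℂ} (hp : p ≠ 0) (hq : q ≠ 1) :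
    p * gammaBeta p q = (q - 1) * gammaBeta (p + 1) (q - 1) := by
  have h := Complex.Gamma_add_one (q - 1) (sub_ne_zero.2 hq)
  rw [sub_add_cancel] at h
  rw [gammaBeta, gammaBeta, Complex.Gamma_add_one _ hp, h, show p + 1 + (q - 1) = p + q by ring]
  ring

/-- The coefficients of `(1 + t / s)^(-a)`. -/
noncomputable def invCoef (s : ℝ) (a : ℂ) (k : ℕ) : ℂ := binCoef a k * (-(s : ℂ)⁻¹) ^ k

theorem norm_neg_inv_lt_one {s : ℝ} (hs : 1 < s) : ‖-(s : ℂ)⁻¹‖ < 1 := by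
  rw [norm_neg, norm_inv, Complex.norm_real, Real.norm_of_nonneg (by linarith)]
  exact inv_lt_one_of_one_lt₀ hs

theorem summable_norm_invCoef {s : ℝ} (hs : 1 < s) (a : ℂ) : Summable fun k ↦ ‖invCoef s a k‖ :=
  summable_norm_binCoef_mul_pow a (norm_neg_inv_lt_one hs)

theorem hasSum_invCoef {s : ℝ} (hs : 1 < s) (a : ℂ) :
    HasSum (invCoef s a) ((1 + (s : ℂ)⁻¹) ^ (-a)) := by
  simpa using! hasSum_one_sub_cpow a (norm_neg_inv_lt_one hs)

theorem succ_mul_invCoef_succ (s : ℝ) (a : ℂ) (k : ℕ) :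
    ((k : ℂ) + 1) * invCoef s a (k + 1) = -(s : ℂ)⁻¹ * (a + k) * invCoef s a k := by
  rw [invCoef, invCoef, ← mul_assoc, succ_mul_binCoef_succ]
  ring

theorem hasSum_powIntegral_inv {s : ℝ} (hs : 1 < s) (a : ℂ) {p : ℂ} (hp : 0 < p.re) :
    HasSum (fun k ↦ invCoef s a k / (p + k)) (powIntegral s⁻¹ a p) := by
  refine hasSum_div_add_natCast hp (summable_norm_invCoef hs a) fun t ht ↦ ?_
  have := hasSum_one_sub_cpow a (z := -(s : ℂ)⁻¹ * t) (by
    rw [norm_mul, Complex.norm_real t, Real.norm_of_nonneg ht.1.le]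
    nlinarith [norm_neg_inv_lt_one hs, ht.1, ht.2, norm_nonneg (-(s : ℂ)⁻¹)])
  simp only [mul_pow, ← mul_assoc] at this
  convert! this using 2
  push_cast
  ring

theorem exists_inv_bound {x : ℂ} (hx : -1 < x.re) (hx0 : x.re < 0) :
    ∃ M : ℝ, ∀ n : ℤ, x + n ≠ 0 ∧ ‖(x + n)⁻¹‖ ≤ M := by
  have hm : 0 < min (-x.re) (1 + x.re) := lt_min (by linarith) (by linarith)
  refine ⟨(min (-x.re) (1 + x.re))⁻¹, fun n ↦ ?_⟩
  have h : min (-x.re) (1 + x.re) ≤ ‖x + n‖ := by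
    refine le_trans ?_ (Complex.abs_re_le_norm _)
    rw [Complex.add_re, Complex.intCast_re]
    rcases le_or_gt n 0 with hn | hn
    · have : (n : ℝ) ≤ 0 := by exact_mod_cast hn
      exact (min_le_left _ _).trans ((by linarith : -x.re ≤ -(x.re + n)).trans (neg_le_abs _))
    · have : (1 : ℝ) ≤ n := by exact_mod_cast hn
      exact (min_le_right _ _).trans ((by linarith : 1 + x.re ≤ x.re + n).trans (le_abs_self _))
  refine ⟨norm_pos_iff.1 (hm.trans_le h), ?_⟩
  rw [norm_inv]
  gcongr

theorem summable_div_of_norm_inv_le {e z : ℕ → ℂ} (he : Summable fun k ↦ ‖e k‖) {M : ℝ}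
    (hz : ∀ k, ‖(z k)⁻¹‖ ≤ M) : Summable fun k ↦ e k / z k := by
  refine Summable.of_norm_bounded (he.mul_right M) fun k ↦ ?_
  rw [div_eq_mul_inv, norm_mul]
  gcongr
  exact hz k

/-- For j = 0 this is the cut of the integral over (0, ∞). For j ≥ 1 that integral diverges, but
both sides obey the same first-order recurrence in j, whose leading coefficient is nonzero because
re (a - b) lies strictly between 0 and 1. -/
theorem powIntegral_add_natCast {a b : ℂ} (hb : 0 < b.re) (hba : b.re < a.re)
    (hab : a.re < b.re + 1) {s : ℝ} (hs : 1 < s) (j : ℕ) :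
    powIntegral s a (b + j) = (s : ℂ) ^ (-(b + j)) * gammaBeta (b + j) (a - (b + j)) -
      (s : ℂ) ^ (-a) * ∑' k : ℕ, invCoef s a k / (a - (b + j) + k) := by
  have hs0 : (s : ℂ) ≠ 0 := by exact_mod_cast (by linarith : s ≠ 0)
  obtain ⟨M, hM⟩ := exists_inv_bound (x := b - a) (by simp; linarith) (by simp; linarith)
  have hz : ∀ j k : ℕ, a - (b + j) + k = -((b - a) + ((j : ℤ) - (k : ℤ) : ℤ)) := fun j k ↦ by
    push_cast; ring
  have hz0 : ∀ j k : ℕ, a - (b + j) + k ≠ 0 := fun j k ↦ by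
    rw [hz, neg_ne_zero]; exact (hM _).1
  have hsum : ∀ j : ℕ, HasSum (fun k : ℕ ↦ invCoef s a k / (a - (b + j) + k))
      (∑' k : ℕ, invCoef s a k / (a - (b + j) + k)) := fun j ↦
    (summable_div_of_norm_inv_le (summable_norm_invCoef hs a) (M := M) fun k ↦ by
      rw [hz, ← neg_inv, norm_neg]; exact (hM _).2).hasSum
  induction j with
  | zero =>
    simp only [Nat.cast_zero, add_zero]
    have hp : 0 < (a - b).re := by simpa using hba
    rw [(hasSum_powIntegral_inv hs a hp).tsum_eq, ← betaIntegral_eq_gammaBeta hb hp,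
      ← powIntegral_add_powIntegral_inv hb hba (by linarith)]
    ring
  | succ j ih =>
    have hq : 0 < (b + j).re := by
      simp only [Complex.add_re, Complex.natCast_re]
      positivity
    have hrec := powIntegral_recurrence hq (by linarith : 0 ≤ s) a
    have hT := hsum j
    have hT' := hsum (j + 1)
    set T := ∑' k : ℕ, invCoef s a k / (a - (b + j) + k)
    set T' := ∑' k : ℕ, invCoef s a k / (a - (b + (j + 1 : ℕ)) + k)
    have hpf := partialFraction_recurrence (succ_mul_invCoef_succ s a) (hz0 (j + 1))
      (hasSum_invCoef hs a) hT' (by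
        convert hT using 4
        push_cast
        ring)
    have hq0 : b + j ≠ 0 := fun h ↦ by simp [h] at hq
    have hne' : b + j + 1 - a ≠ 0 := by
      have := hz0 (j + 1) 0
      push_cast at this
      intro h
      exact this (by linear_combination -h)
    have hB := mul_gammaBeta_sub_one hq0 (q := a - (b + j)) (fun h ↦ hne' (by linear_combination -h))
    rw [ih] at hrec
    have hpow : (1 + (s : ℂ)) ^ (1 - a) = (1 + s) * ((s : ℂ) ^ (-a) * (1 + (s : ℂ)⁻¹) ^ (-a)) := by
      have h1 : (1 + (s : ℂ)) = (s : ℝ) * ((1 + s⁻¹ : ℝ) : ℂ) := by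
        push_cast
        field_simp
        ring
      have h2 : (1 + (s : ℂ)) ≠ 0 := by exact_mod_cast (by linarith : 1 + s ≠ 0)
      rw [sub_eq_add_neg, Complex.cpow_add _ _ h2, Complex.cpow_one]
      nth_rewrite 2 [h1]
      rw [Complex.mul_cpow_ofReal_nonneg (by linarith) (by positivity)]
      push_cast
      rfl
    have hpow2 : (s : ℂ) ^ (-(b + j)) = s * (s : ℂ) ^ (-(b + (j + 1 : ℕ))) := by
      rw [show -(b + (j : ℂ)) = 1 + -(b + (j + 1 : ℕ)) by push_cast; ring, Complex.cpow_add _ _ hs0,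
        Complex.cpow_one]
    have hcast : b + ((j + 1 : ℕ) : ℂ) = b + j + 1 := by push_cast; ring
    rw [hcast] at hpf hpow2 ⊢
    rw [show a - (b + j + 1) = a - (b + j) - 1 by ring]
    refine mul_left_cancel₀ (mul_ne_zero hs0 hne') ?_
    rw [hpow2] at hrec
    rw [hpow] at hrec
    rw [show a - (a - (b + ↑j + 1)) - 1 = b + j by ring] at hpf
    set P := (1 + (s : ℂ)⁻¹) ^ (-a)
    set Q := (s : ℂ) ^ (-a)
    set R := (s : ℂ) ^ (-(b + j + 1))
    have hpf' : s * P - s * (a - (b + j + 1)) * T' = -(P + (b + j) * T) := by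
      have := congrArg (fun x ↦ (s : ℂ) * x) hpf
      rw [← mul_assoc (s : ℂ) (-(s : ℂ)⁻¹), mul_neg, mul_inv_cancel₀ hs0] at this
      linear_combination this
    linear_combination hrec - s * R * hB + Q * hpf'

theorem hasSum_binCoef_div {d : ℂ} (hd : 1 < d.re) {p : ℂ} (hp : 0 < p.re) :
    HasSum (fun j ↦ binCoef (1 - d) j / (p + j)) (gammaBeta p d) := by
  rw [← betaIntegral_eq_gammaBeta hp (by linarith)]
  refine hasSum_div_add_natCast hp (summable_norm_binCoef (by simpa using hd)) fun t ht ↦ ?_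
  have := hasSum_one_sub_cpow (1 - d) (z := t) (by
    rw [Complex.norm_real t, Real.norm_of_nonneg ht.1.le]; exact ht.2)
  rwa [neg_sub] at this

/-- Downward induction from x + 1, whose real part is positive so that the beta integral applies.
With l = 1 the full sum S cancels from the partial fraction recurrence, leaving the functional
equation of `gammaBeta`. -/
theorem hasSum_binCoef_div_sub_natCast {d : ℂ} (hd : 1 < d.re) {x : ℂ} (hx : -1 < x.re)
    (hx0 : x.re < 0) (k : ℕ) :
    HasSum (fun j : ℕ ↦ binCoef (1 - d) j / (x + 1 - k + j)) (gammaBeta (x + 1 - k) d) := by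
  obtain ⟨M, hM⟩ := exists_inv_bound hx hx0
  have hz : ∀ j k : ℕ, x + 1 - k + j = x + (1 - (k : ℤ) + (j : ℤ) : ℤ) := fun j k ↦ by
    push_cast; ring
  have hz0 : ∀ j k : ℕ, x + 1 - k + j ≠ 0 := fun j k ↦ by
    rw [hz]; exact (hM _).1
  have hD : Summable fun j ↦ ‖binCoef (1 - d) j‖ := summable_norm_binCoef (by simpa using hd)
  induction k with
  | zero => simpa using hasSum_binCoef_div hd (p := x + 1) (by simp; linarith)
  | succ k ih =>
    have hW : Summable fun j : ℕ ↦ binCoef (1 - d) j / (x + 1 - (k + 1 : ℕ) + j) :=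
      summable_div_of_norm_inv_le hD fun j ↦ by rw [hz]; exact (hM _).2
    have hp0 : x + 1 - ((k + 1 : ℕ) : ℂ) ≠ 0 := by simpa using hz0 0 (k + 1)
    have hpf := partialFraction_recurrence (l := 1) (α := 1 - d)
      (fun j ↦ by rw [succ_mul_binCoef_succ, one_mul]) (fun j ↦ hz0 j (k + 1))
      hD.of_norm.hasSum hW.hasSum (by
        convert ih using 4
        push_cast
        ring)
    convert hW.hasSum using 1
    refine mul_left_cancel₀ hp0 ?_
    rw [mul_gammaBeta hp0]
    rw [show x + 1 - ((k + 1 : ℕ) : ℂ) + 1 = x + 1 - k by push_cast; ring]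
    linear_combination hpf

/-- The two-term expansion of Euler's integral in powers of `s⁻¹`. -/
theorem eulerIntegral_neg_expansion {a b d : ℂ} (hb : 0 < b.re) (hba : b.re < a.re)
    (hab : a.re < b.re + 1) (hd : 1 < d.re) {s : ℝ} (hs : 1 < s) :
    ∃ Y : ℂ, HasSum (fun k : ℕ ↦ invCoef s a k * gammaBeta (b - a - k) d) Y ∧
      HasSum (fun j : ℕ ↦ binCoef (1 - d) j *
        ((s : ℂ) ^ (-(b + j)) * gammaBeta (b + j) (a - (b + j))))
        (eulerIntegral a b d (-s) - (s : ℂ) ^ (-a) * Y) := by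
  have hx : -1 < (b - a).re := by simp; linarith
  have hx0 : (b - a).re < 0 := by simp; linarith
  obtain ⟨M, hM⟩ := exists_inv_bound hx hx0
  have hD : Summable fun j ↦ ‖binCoef (1 - d) j‖ := summable_norm_binCoef (by simpa using hd)
  have hI : HasSum (fun j : ℕ ↦ binCoef (1 - d) j * powIntegral s a (b + j))
      (eulerIntegral a b d (-s)) := by
    have key := hasSum_intervalIntegral_mul (intervalIntegrable_cpow_mul hb (by linarith : 0 ≤ s) a)
      (φ := fun j t ↦ binCoef (1 - d) j * (t : ℂ) ^ j) (f := fun t ↦ (1 - (t : ℂ)) ^ (d - 1)) hD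
      (fun k ↦ by fun_prop) (fun k t ht ↦ ?_) fun t ht ↦ ?_
    · convert key.congr_fun fun j ↦ ?_ using 1
      · refine intervalIntegral.integral_congr fun t _ ↦ ?_
        simp only [neg_mul, sub_neg_eq_add]
        ring
      · rw [powIntegral, ← intervalIntegral.integral_const_mul]
        refine intervalIntegral.integral_congr_ae (MeasureTheory.ae_of_all _ fun t ht ↦ ?_)
        rw [Set.uIoc_of_le zero_le_one] at ht
        have ht0 : (t : ℂ) ≠ 0 := by exact_mod_cast ht.1.ne'
        rw [add_sub_right_comm, Complex.cpow_add _ _ ht0, Complex.cpow_natCast]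
        ring
    · have : ‖(t : ℂ)‖ ≤ 1 := by
        rw [Complex.norm_real, Real.norm_of_nonneg ht.1]; exact ht.2
      rw [norm_mul, norm_pow]
      exact mul_le_of_le_one_right (norm_nonneg _) (pow_le_one₀ (norm_nonneg _) this)
    · have := hasSum_one_sub_cpow (1 - d) (z := t) (by
        rw [Complex.norm_real t, Real.norm_of_nonneg ht.1.le]; exact ht.2)
      rwa [neg_sub] at this
  -- The denominators b - a + j - k stay away from 0, so the double series is dominated by a product
  -- of two absolutely convergent series and may be summed in either order.
  have hF : Summable fun p : ℕ × ℕ ↦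
      binCoef (1 - d) p.1 * invCoef s a p.2 * (b - a + ((p.1 : ℤ) - (p.2 : ℤ) : ℤ))⁻¹ := by
    refine Summable.of_norm_bounded ((hD.mul_norm (summable_norm_invCoef hs a)).mul_right M)
      fun p ↦ ?_
    rw [norm_mul]
    gcongr
    exact (hM _).2
  have hcol : ∀ k : ℕ, ∑' j : ℕ, binCoef (1 - d) j * invCoef s a k *
      (b - a + ((j : ℤ) - (k : ℤ) : ℤ))⁻¹ = invCoef s a k * gammaBeta (b - a - k) d := fun k ↦ by
    have h := (hasSum_binCoef_div_sub_natCast hd hx hx0 (k + 1)).mul_left (invCoef s a k)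
    rw [show b - a + 1 - ((k + 1 : ℕ) : ℂ) = b - a - k by push_cast; ring] at h
    rw [← h.tsum_eq]
    refine tsum_congr fun j ↦ ?_
    rw [show b - a + (((j : ℤ) - (k : ℤ) : ℤ) : ℂ) = b - a - k + j by push_cast; ring]
    ring
  refine ⟨∑' k : ℕ, ∑' j : ℕ, binCoef (1 - d) j * invCoef s a k *
      (b - a + ((j : ℤ) - (k : ℤ) : ℤ))⁻¹, ?_, ?_⟩
  · simp_rw [← hcol]
    exact hF.prod_symm.prod.hasSum
  · have hcomm := Summable.tsum_comm (f := fun j k : ℕ ↦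
      binCoef (1 - d) j * invCoef s a k * (b - a + ((j : ℤ) - (k : ℤ) : ℤ))⁻¹) hF
    rw [hcomm]
    refine (hI.sub (hF.prod.hasSum.mul_left _)).congr_fun fun j ↦ ?_
    rw [powIntegral_add_natCast hb hba hab hs]
    have : ∑' k : ℕ, binCoef (1 - d) j * invCoef s a k * (b - a + ((j : ℤ) - (k : ℤ) : ℤ))⁻¹ =
        -(binCoef (1 - d) j * ∑' k : ℕ, invCoef s a k / (a - (b + j) + k)) := by
      rw [← tsum_mul_left, ← tsum_neg]
      refine tsum_congr fun k ↦ ?_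
      rw [show a - (b + j) + k = -((b - a) + ((j : ℤ) - (k : ℤ) : ℤ)) by push_cast; ring, div_neg]
      ring
    rw [this]
    ring

/-! ### The terms of the expansion as holomorphic functions of the parameters. -/

/-- The recurrence is kept multiplied out because denominators may vanish for small k; on a compact
set they are nonzero for all large k, which is all the ratio test needs. -/
theorem exists_summable_bound_of_rational_ratio {X : Type*} [TopologicalSpace X] {K : Set X}
    (hK : IsCompact K) {f : ℕ → X → ℂ} {num den : Fin 3 → X → ℂ} {l : ℂ} (hl : ‖l‖ < 1)
    (hf : ∀ k, ContinuousOn (f k) K) (hnum : ∀ i, ContinuousOn (num i) K)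
    (hden : ∀ i, ContinuousOn (den i) K)
    (hstep : ∀ k, ∀ x ∈ K, f (k + 1) x * ∏ i, (den i x + k) = l * f k x * ∏ i, (num i x + k)) :
    ∃ u : ℕ → ℝ, Summable u ∧ ∀ k, ∀ x ∈ K, ‖f k x‖ ≤ u k := by
  choose A hA using fun i ↦ hK.exists_bound_of_continuousOn (hnum i)
  choose B hB using fun i ↦ hK.exists_bound_of_continuousOn (hden i)
  refine exists_summable_bound_of_ratio hl
    (ρ := fun k ↦ (∏ i, ((k : ℝ) + A i) / (k + -B i)) * ‖l‖) ?_
    (fun k ↦ hK.exists_bound_of_continuousOn (hf k)) ?_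
  · have := (tendsto_finsetProd Finset.univ fun i (_ : i ∈ Finset.univ) ↦
      tendsto_natCast_add_div_natCast_add (A i) (-B i)).mul_const ‖l‖
    simpa using this
  · have hev : ∀ᶠ k : ℕ in atTop, ∀ i, 0 < (k : ℝ) + -B i := eventually_all.2 fun i ↦ by
      filter_upwards [eventually_gt_atTop ⌈|B i|⌉₊] with k hk
      have := Nat.lt_of_ceil_lt hk
      linarith [le_abs_self (B i)]
    filter_upwards [hev] with k hk x hx
    have hpos : ∀ i, 0 < ‖den i x + k‖ := fun i ↦
      (hk i).trans_le (sub_le_norm_add_natCast (hB i x hx) k)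
    have h0 : (∏ i, (den i x + k)) ≠ 0 :=
      Finset.prod_ne_zero_iff.2 fun i _ ↦ norm_pos_iff.1 (hpos i)
    rw [eq_div_of_mul_eq h0 (hstep k x hx), norm_div, norm_mul, norm_mul, norm_prod, norm_prod,
      mul_div_assoc, ← Finset.prod_div_distrib, mul_right_comm, mul_comm ‖l‖, Finset.prod_div_distrib,
      Finset.prod_div_distrib]
    have h1 : ∏ i, ‖num i x + k‖ ≤ ∏ i, ((k : ℝ) + A i) :=
      Finset.prod_le_prod (fun _ _ ↦ norm_nonneg _) fun i _ ↦ norm_add_natCast_le (hA i x hx) k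
    have h2 : ∏ i, ((k : ℝ) + -B i) ≤ ∏ i, ‖den i x + k‖ :=
      Finset.prod_le_prod (fun i _ ↦ (hk i).le) fun i _ ↦ sub_le_norm_add_natCast (hB i x hx) k
    have h3 : 0 < ∏ i, ((k : ℝ) + -B i) := Finset.prod_pos fun i _ ↦ hk i
    have h4 : 0 ≤ ∏ i, ((k : ℝ) + A i) := (Finset.prod_nonneg fun _ _ ↦ norm_nonneg _).trans h1
    gcongr

theorem exists_summable_bound_of_rational_ratio₃ {X : Type*} [TopologicalSpace X] {K : Set X}
    (hK : IsCompact K) {f : ℕ → X → ℂ} {n₁ n₂ n₃ d₁ d₂ d₃ : X → ℂ} {l : ℂ} (hl : ‖l‖ < 1)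
    (hf : ∀ k, ContinuousOn (f k) K) (hn₁ : ContinuousOn n₁ K) (hn₂ : ContinuousOn n₂ K)
    (hn₃ : ContinuousOn n₃ K) (hd₁ : ContinuousOn d₁ K) (hd₂ : ContinuousOn d₂ K)
    (hd₃ : ContinuousOn d₃ K)
    (hstep : ∀ k : ℕ, ∀ x ∈ K, f (k + 1) x * ((d₁ x + k) * (d₂ x + k) * (d₃ x + k)) =
      l * f k x * ((n₁ x + k) * (n₂ x + k) * (n₃ x + k))) :
    ∃ u : ℕ → ℝ, Summable u ∧ ∀ k, ∀ x ∈ K, ‖f k x‖ ≤ u k := by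
  refine exists_summable_bound_of_rational_ratio hK (num := ![n₁, n₂, n₃]) (den := ![d₁, d₂, d₃])
    hl hf ?_ ?_ fun k x hx ↦ ?_
  · intro i
    fin_cases i
    exacts [hn₁, hn₂, hn₃]
  · intro i
    fin_cases i
    exacts [hd₁, hd₂, hd₃]
  · rw [Fin.prod_univ_three, Fin.prod_univ_three]
    exact hstep k x hx

/-- The reciprocal gamma function. -/
noncomputable def rGamma (z : ℂ) : ℂ := (Complex.Gamma z)⁻¹

theorem differentiable_rGamma : Differentiable ℂ rGamma := Complex.differentiable_one_div_Gamma

theorem continuous_rGamma : Continuous rGamma := differentiable_rGamma.continuous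

theorem hasDerivAt_rGamma (z : ℂ) : HasDerivAt rGamma (deriv rGamma z) z :=
  (differentiable_rGamma z).hasDerivAt

theorem differentiable_deriv_rGamma : Differentiable ℂ (deriv rGamma) :=
  differentiableOn_univ.1 (differentiable_rGamma.differentiableOn.deriv isOpen_univ)

theorem rGamma_eq_mul (z : ℂ) : rGamma z = z * rGamma (z + 1) :=
  Complex.one_div_Gamma_eq_self_mul_one_div_Gamma_add_one z

theorem rGamma_natCast_add_one (k : ℕ) : rGamma ((k : ℂ) + 1) = (Nat.factorial k : ℂ)⁻¹ := by
  rw [rGamma, Complex.Gamma_nat_eq_factorial]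

theorem ascPochhammer_mul_rGamma (z : ℂ) (k : ℕ) :
    (ascPochhammer ℂ k).eval z * rGamma (z + k) = rGamma z := by
  induction k with
  | zero => simp
  | succ k ih =>
    rw [ascPochhammer_succ_eval, mul_assoc, Nat.cast_succ, ← add_assoc, ← rGamma_eq_mul, ih]

theorem rGamma_sub_natCast (z : ℂ) (k : ℕ) :
    rGamma (z - k) = (-1) ^ k * (ascPochhammer ℂ k).eval (1 - z) * rGamma z := by
  induction k with
  | zero => simp
  | succ k ih =>
    rw [rGamma_eq_mul, show z - ((k + 1 : ℕ) : ℂ) + 1 = z - k by push_cast; ring, ih,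
      ascPochhammer_succ_eval]
    push_cast
    ring

/-- The generating function `δ ↦ s^(-a-k-δ) (a)ₖ² / (Γ(a+k-δ) Γ(c-a-k-δ) Γ(k+1+δ)²)`, whose
derivative at `0` gives the terms of the expansion. -/
noncomputable def expGen (s : ℝ) (k : ℕ) (a c δ : ℂ) : ℂ :=
  (ascPochhammer ℂ k).eval a ^ 2 * (rGamma (a + k - δ) * rGamma (c - a - k - δ) *
    rGamma (k + 1 + δ) ^ 2) * (s : ℂ) ^ (-(a + k + δ))

/-- The terms of the expansion, extended continuously to all parameters. -/
noncomputable def limitTerm (s : ℝ) (a c : ℂ) (k : ℕ) : ℂ :=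
  -Complex.Gamma c * deriv (expGen s k a c) 0

theorem hasDerivAt_const_cpow_neg {s : ℝ} (hs : 0 < s) (x y : ℂ) :
    HasDerivAt (fun δ : ℂ ↦ (s : ℂ) ^ (-(x + δ))) (-((s : ℂ) ^ (-(x + y)) * Real.log s)) y := by
  have hs0 : (s : ℂ) ≠ 0 := by exact_mod_cast hs.ne'
  have h := ((hasDerivAt_id y).const_add x).neg.const_cpow (c := (s : ℂ)) (Or.inl hs0)
  refine h.congr_deriv ?_
  rw [Complex.ofReal_log hs.le]
  simp

/-- The closed form of the derivative at `0` of `expGen`. -/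
noncomputable def expGenDeriv (s : ℝ) (k : ℕ) (a c : ℂ) : ℂ :=
  (ascPochhammer ℂ k).eval a ^ 2 * (s : ℂ) ^ (-(a + k)) *
    (-(deriv rGamma (a + k) * rGamma (c - a - k) * rGamma (k + 1) ^ 2)
      - rGamma (a + k) * deriv rGamma (c - a - k) * rGamma (k + 1) ^ 2
      + 2 * rGamma (a + k) * rGamma (c - a - k) * rGamma (k + 1) * deriv rGamma (k + 1)
      - Real.log s * rGamma (a + k) * rGamma (c - a - k) * rGamma (k + 1) ^ 2)

theorem hasDerivAt_rGamma_const_sub (x y : ℂ) :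
    HasDerivAt (fun δ ↦ rGamma (x - δ)) (-deriv rGamma (x - y)) y := by
  have := (hasDerivAt_rGamma (x - y)).comp y ((hasDerivAt_id y).const_sub x)
  simpa using! this

theorem hasDerivAt_rGamma_const_add (x y : ℂ) :
    HasDerivAt (fun δ ↦ rGamma (x + δ)) (deriv rGamma (x + y)) y := by
  have := (hasDerivAt_rGamma (x + y)).comp y ((hasDerivAt_id y).const_add x)
  simpa using! this

theorem hasDerivAt_expGen {s : ℝ} (hs : 0 < s) (k : ℕ) (a c : ℂ) :
    HasDerivAt (expGen s k a c) (expGenDeriv s k a c) 0 := by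
  have h1 := hasDerivAt_rGamma_const_sub (a + k) 0
  have h2 := hasDerivAt_rGamma_const_sub (c - a - k) 0
  have h3 := (hasDerivAt_rGamma_const_add (k + 1) 0).pow 2
  have h4 := hasDerivAt_const_cpow_neg hs (a + k) 0
  refine ((((h1.mul h2).mul h3).const_mul ((ascPochhammer ℂ k).eval a ^ 2)).mul h4).congr_deriv ?_
  simp only [Pi.mul_apply, Pi.pow_apply, sub_zero, add_zero, expGenDeriv]
  push_cast
  ring

theorem limitTerm_eq {s : ℝ} (hs : 0 < s) (a c : ℂ) (k : ℕ) :
    limitTerm s a c k = -Complex.Gamma c * expGenDeriv s k a c := by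
  rw [limitTerm, (hasDerivAt_expGen hs k a c).deriv]

theorem continuous_expGen {s : ℝ} (hs : 0 < s) (k : ℕ) :
    Continuous fun p : ℂ × ℂ × ℂ ↦ expGen s k p.1 p.2.1 p.2.2 := by
  have hs0 : (s : ℂ) ≠ 0 := by exact_mod_cast hs.ne'
  refine Continuous.mul (Continuous.mul (((continuous_ascPochhammer_eval k).comp
    continuous_fst).pow 2) (((continuous_rGamma.comp (by fun_prop)).mul
    (continuous_rGamma.comp (by fun_prop))).mul ((continuous_rGamma.comp (by fun_prop)).pow 2)))
    (Continuous.const_cpow (by fun_prop) (Or.inl hs0))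

theorem expGen_succ {s : ℝ} (hs : 0 < s) (k : ℕ) (a c δ : ℂ) :
    expGen s (k + 1) a c δ * ((a - δ + k) * (1 + δ + k) * (1 + δ + k)) =
      -(s : ℂ)⁻¹ * expGen s k a c δ * ((a + k) * (a + k) * (1 + a - c + δ + k)) := by
  have hs0 : (s : ℂ) ≠ 0 := by exact_mod_cast hs.ne'
  have h1 := rGamma_eq_mul (a + k - δ)
  have h2 := rGamma_eq_mul (c - a - (k + 1) - δ)
  have h3 := rGamma_eq_mul (k + 1 + δ)
  have h4 : (s : ℂ) ^ (-(a + (k + 1) + δ)) = (s : ℂ)⁻¹ * (s : ℂ) ^ (-(a + k + δ)) := by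
    rw [show -(a + ((k : ℂ) + 1) + δ) = -1 + -(a + k + δ) by ring, Complex.cpow_add _ _ hs0,
      Complex.cpow_neg_one]
  rw [show c - a - ((k : ℂ) + 1) - δ + 1 = c - a - k - δ by ring] at h2
  simp only [expGen, ascPochhammer_succ_eval, Nat.cast_succ]
  rw [h4, h2, h1, h3, show a + ((k : ℂ) + 1) - δ = a + k - δ + 1 by ring,
    show (k : ℂ) + 1 + 1 + δ = k + 1 + δ + 1 by ring]
  generalize rGamma (a + k - δ + 1) = A
  generalize rGamma (c - a - k - δ) = B
  generalize rGamma (k + 1 + δ + 1) = C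
  generalize (s : ℂ) ^ (-(a + k + δ)) = S
  generalize (s : ℂ)⁻¹ = T
  generalize (ascPochhammer ℂ k).eval a = P
  generalize (k : ℂ) = κ
  ring

theorem exists_expGen_bound {s : ℝ} (hs : 1 < s) {X : Type*} [TopologicalSpace X] {K : Set X}
    (hK : IsCompact K) {a c δ : X → ℂ} (ha : ContinuousOn a K) (hc : ContinuousOn c K)
    (hδ : ContinuousOn δ K) :
    ∃ u : ℕ → ℝ, Summable u ∧ ∀ k, ∀ x ∈ K, ‖expGen s k (a x) (c x) (δ x)‖ ≤ u k := by
  have hs' : 0 < s := by linarith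
  exact exists_summable_bound_of_rational_ratio₃ hK (norm_neg_inv_lt_one hs)
    (f := fun k x ↦ expGen s k (a x) (c x) (δ x)) (n₃ := fun x ↦ 1 + a x - c x + δ x)
    (d₁ := fun x ↦ a x - δ x) (d₂ := fun x ↦ 1 + δ x) (d₃ := fun x ↦ 1 + δ x)
    (fun k ↦ (continuous_expGen hs' k).comp_continuousOn (f := fun x ↦ (a x, c x, δ x))
      (ha.prodMk (hc.prodMk hδ))) ha ha
    (by fun_prop) (by fun_prop) (by fun_prop) (by fun_prop)
    fun k x _ ↦ expGen_succ hs' k (a x) (c x) (δ x)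

theorem differentiableOn_Gamma_nonpolar : DifferentiableOn ℂ Complex.Gamma nonpolar :=
  fun c hc ↦ (Complex.differentiableAt_Gamma c hc).differentiableWithinAt

/-- Cauchy's estimate on the circle |δ| = 1 transfers the bound on `expGen` to its derivative, so no
digamma values have to be estimated. -/
theorem exists_limitTerm_bound {s : ℝ} (hs : 1 < s) {X : Type*} [TopologicalSpace X] {K : Set X}
    (hK : IsCompact K) {a c : X → ℂ} (ha : ContinuousOn a K) (hc : ContinuousOn c K)
    (hcn : ∀ x ∈ K, c x ∈ nonpolar) :
    ∃ u : ℕ → ℝ, Summable u ∧ ∀ k, ∀ x ∈ K, ‖limitTerm s (a x) (c x) k‖ ≤ u k := by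
  have hfst : Set.MapsTo Prod.fst (K ×ˢ Metric.closedBall (0 : ℂ) 1) K := fun p hp ↦ hp.1
  obtain ⟨u, hu, hle⟩ := exists_expGen_bound hs (hK.prod (isCompact_closedBall (0 : ℂ) 1))
    (a := fun p ↦ a p.1) (c := fun p ↦ c p.1) (δ := fun p ↦ p.2)
    (ha.comp continuousOn_fst hfst) (hc.comp continuousOn_fst hfst) continuousOn_snd
  obtain ⟨G, hG⟩ := hK.exists_bound_of_continuousOn
    (differentiableOn_Gamma_nonpolar.continuousOn.comp hc hcn)
  refine ⟨fun k ↦ G * (u k / 1), (hu.div_const 1).mul_left G, fun k x hx ↦ ?_⟩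
  rw [limitTerm, norm_mul, norm_neg]
  refine mul_le_mul (hG x hx) ?_ (norm_nonneg _) ((norm_nonneg _).trans (hG x hx))
  refine Complex.norm_deriv_le_of_forall_mem_sphere_norm_le one_pos ?_ fun z hz ↦
    hle k (x, z) ⟨hx, Metric.sphere_subset_closedBall hz⟩
  have hs0 : (s : ℂ) ≠ 0 := by exact_mod_cast (by linarith : s ≠ 0)
  refine Differentiable.diffContOnCl (Differentiable.mul (Differentiable.mul (by fun_prop)
    (((differentiable_rGamma.comp (by fun_prop)).mul (differentiable_rGamma.comp (by fun_prop))).mul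
    ((differentiable_rGamma.comp (by fun_prop)).pow 2))) fun z ↦
    DifferentiableAt.const_cpow (by fun_prop) (Or.inl hs0))

theorem summable_norm_limitTerm {s : ℝ} (hs : 1 < s) (a : ℂ) {c : ℂ} (hc : c ∈ nonpolar) :
    Summable fun k ↦ ‖limitTerm s a c k‖ := by
  obtain ⟨u, hu, hle⟩ := exists_limitTerm_bound hs (X := Unit) (a := fun _ ↦ a) (c := fun _ ↦ c)
    isCompact_univ continuousOn_const continuousOn_const (fun _ _ ↦ hc)
  exact hu.of_nonneg_of_le (fun _ ↦ norm_nonneg _) fun k ↦ hle k () trivial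

theorem differentiable_expGenDeriv_left {s : ℝ} (hs : 0 < s) (k : ℕ) (c : ℂ) :
    Differentiable ℂ fun a ↦ expGenDeriv s k a c := by
  have hs0 : (s : ℂ) ≠ 0 := by exact_mod_cast hs.ne'
  have h1 : Differentiable ℂ fun a : ℂ ↦ rGamma (a + k) :=
    differentiable_rGamma.comp (by fun_prop)
  have h2 : Differentiable ℂ fun a : ℂ ↦ rGamma (c - a - k) :=
    differentiable_rGamma.comp (by fun_prop)
  have h3 : Differentiable ℂ fun a : ℂ ↦ deriv rGamma (a + k) :=
    differentiable_deriv_rGamma.comp (by fun_prop)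
  have h4 : Differentiable ℂ fun a : ℂ ↦ deriv rGamma (c - a - k) :=
    differentiable_deriv_rGamma.comp (by fun_prop)
  have h5 : Differentiable ℂ fun a : ℂ ↦ (s : ℂ) ^ (-(a + k)) := fun a ↦
    DifferentiableAt.const_cpow (by fun_prop) (Or.inl hs0)
  have h6 := differentiable_ascPochhammer_eval k
  unfold expGenDeriv
  fun_prop

theorem differentiable_expGenDeriv_right (s : ℝ) (k : ℕ) (a : ℂ) :
    Differentiable ℂ fun c ↦ expGenDeriv s k a c := by
  have h2 : Differentiable ℂ fun c : ℂ ↦ rGamma (c - a - k) :=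
    differentiable_rGamma.comp (by fun_prop)
  have h4 : Differentiable ℂ fun c : ℂ ↦ deriv rGamma (c - a - k) :=
    differentiable_deriv_rGamma.comp (by fun_prop)
  unfold expGenDeriv
  fun_prop

theorem continuous_expGenDeriv {s : ℝ} (hs : 0 < s) (k : ℕ) :
    Continuous fun p : ℂ × ℂ ↦ expGenDeriv s k p.1 p.2 := by
  have hs0 : (s : ℂ) ≠ 0 := by exact_mod_cast hs.ne'
  have h1 : Continuous fun p : ℂ × ℂ ↦ rGamma (p.1 + k) := continuous_rGamma.comp (by fun_prop)
  have h2 : Continuous fun p : ℂ × ℂ ↦ rGamma (p.2 - p.1 - k) :=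
    continuous_rGamma.comp (by fun_prop)
  have h3 : Continuous fun p : ℂ × ℂ ↦ deriv rGamma (p.1 + k) :=
    differentiable_deriv_rGamma.continuous.comp (by fun_prop)
  have h4 : Continuous fun p : ℂ × ℂ ↦ deriv rGamma (p.2 - p.1 - k) :=
    differentiable_deriv_rGamma.continuous.comp (by fun_prop)
  have h5 : Continuous fun p : ℂ × ℂ ↦ (s : ℂ) ^ (-(p.1 + k)) :=
    Continuous.const_cpow (by fun_prop) (Or.inl hs0)
  have h6 : Continuous fun p : ℂ × ℂ ↦ (ascPochhammer ℂ k).eval p.1 :=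
    (continuous_ascPochhammer_eval k).comp continuous_fst
  unfold expGenDeriv
  fun_prop

theorem differentiable_tsum_limitTerm_left {s : ℝ} (hs : 1 < s) {c : ℂ} (hc : c ∈ nonpolar) :
    Differentiable ℂ fun a ↦ ∑' k, limitTerm s a c k := by
  refine differentiableOn_univ.1 (differentiableOn_tsum_of_compact_bound isOpen_univ
    (F := fun k a ↦ limitTerm s a c k) (fun k ↦ ?_) fun K _ hK ↦
    exists_limitTerm_bound hs hK continuousOn_id continuousOn_const fun _ _ ↦ hc)
  simp_rw [limitTerm_eq (by linarith : 0 < s)]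
  exact ((differentiable_expGenDeriv_left (by linarith) k c).const_mul _).differentiableOn

theorem differentiableOn_tsum_limitTerm_right {s : ℝ} (hs : 1 < s) (a : ℂ) :
    DifferentiableOn ℂ (fun c ↦ ∑' k, limitTerm s a c k) nonpolar := by
  refine differentiableOn_tsum_of_compact_bound isOpen_nonpolar
    (F := fun k c ↦ limitTerm s a c k) (fun k ↦ ?_) fun K hKU hK ↦
    exists_limitTerm_bound hs hK continuousOn_const continuousOn_id fun _ hx ↦ hKU hx
  simp_rw [limitTerm_eq (by linarith : 0 < s)]
  exact differentiableOn_Gamma_nonpolar.neg.mul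
    (differentiable_expGenDeriv_right s k a).differentiableOn

/-! ### The confluent limit a → b. -/

/-- The first of the two families whose difference is divided by `sin (π δ)`. -/
noncomputable def leftGen (s : ℝ) (b d : ℂ) (k : ℕ) (δ : ℂ) : ℂ :=
  binCoef (b + δ) k * (s : ℂ) ^ (-(b + k + δ)) * (rGamma (k + 1 + δ) * rGamma (d - k - δ))

/-- The second of the two families whose difference is divided by `sin (π δ)`. -/
noncomputable def rightGen (s : ℝ) (b d : ℂ) (k : ℕ) (δ : ℂ) : ℂ :=
  (-1) ^ k * binCoef (1 - d) k * (s : ℂ) ^ (-(b + k)) * Complex.Gamma (b + k) *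
    (rGamma (k + 1 - δ) * rGamma (b + δ))

theorem differentiable_binCoef (k : ℕ) : Differentiable ℂ fun a ↦ binCoef a k :=
  (differentiable_ascPochhammer_eval k).div_const _

theorem differentiable_leftGen {s : ℝ} (hs : 0 < s) (b d : ℂ) (k : ℕ) :
    Differentiable ℂ (leftGen s b d k) := by
  have hs0 : (s : ℂ) ≠ 0 := by exact_mod_cast hs.ne'
  exact (((differentiable_binCoef k).comp (by fun_prop)).mul fun δ ↦
    DifferentiableAt.const_cpow (by fun_prop) (Or.inl hs0)).mul
    ((differentiable_rGamma.comp (by fun_prop)).mul (differentiable_rGamma.comp (by fun_prop)))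

theorem differentiable_rightGen (s : ℝ) (b d : ℂ) (k : ℕ) :
    Differentiable ℂ (rightGen s b d k) :=
  Differentiable.const_mul ((differentiable_rGamma.comp (by fun_prop)).mul
    (differentiable_rGamma.comp (by fun_prop))) _

theorem cpow_neg_add_one {s : ℝ} (hs : 0 < s) (x : ℂ) :
    (s : ℂ) ^ (-(x + 1)) = (s : ℂ)⁻¹ * (s : ℂ) ^ (-x) := by
  have hs0 : (s : ℂ) ≠ 0 := by exact_mod_cast hs.ne'
  rw [neg_add_rev, Complex.cpow_add _ _ hs0, Complex.cpow_neg_one]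

/-- The last factor 1 + k on either side pads the ratio to three factors, the shape the bound
expects. -/
theorem leftGen_succ {s : ℝ} (hs : 0 < s) (b d : ℂ) (k : ℕ) (δ : ℂ) :
    leftGen s b d (k + 1) δ * ((1 + k) * (1 + δ + k) * (1 + k)) =
      -(s : ℂ)⁻¹ * leftGen s b d k δ * ((b + δ + k) * (1 - d + δ + k) * (1 + k)) := by
  have h1 := succ_mul_binCoef_succ (b + δ) k
  have h2 := rGamma_eq_mul (d - (k + 1) - δ)
  have h3 := rGamma_eq_mul (k + 1 + δ)
  have h4 := cpow_neg_add_one hs (b + k + δ)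
  rw [show d - ((k : ℂ) + 1) - δ + 1 = d - k - δ by ring] at h2
  simp only [leftGen, Nat.cast_succ]
  rw [show b + ((k : ℂ) + 1) + δ = b + k + δ + 1 by ring, h4, h2, h3,
    show (k : ℂ) + 1 + 1 + δ = k + 1 + δ + 1 by ring]
  generalize rGamma (d - k - δ) = B
  generalize rGamma (k + 1 + δ + 1) = C
  generalize (s : ℂ) ^ (-(b + k + δ)) = S
  generalize (s : ℂ)⁻¹ = T
  linear_combination T * S * C * (d - (k + 1) - δ) * B * (1 + δ + k) * (1 + k) * h1

theorem rightGen_succ {s : ℝ} (hs : 0 < s) {b : ℂ} (hb : 0 < b.re) (d : ℂ) (k : ℕ) (δ : ℂ) :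
    rightGen s b d (k + 1) δ * ((1 + k) * (1 - δ + k) * (1 + k)) =
      -(s : ℂ)⁻¹ * rightGen s b d k δ * ((1 - d + k) * (b + k) * (1 + k)) := by
  have h1 := succ_mul_binCoef_succ (1 - d) k
  have h3 := rGamma_eq_mul (k + 1 - δ)
  have h4 := cpow_neg_add_one hs (b + k)
  have hbk : b + k ≠ 0 := fun h ↦
    ne_neg_natCast_of_re_pos hb k (eq_neg_of_add_eq_zero_left h)
  have h5 := Complex.Gamma_add_one _ hbk
  simp only [rightGen, Nat.cast_succ]
  rw [show b + ((k : ℂ) + 1) = b + k + 1 by ring, h4, h3, h5,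
    show (k : ℂ) + 1 + 1 - δ = k + 1 - δ + 1 by ring, pow_succ]
  generalize rGamma (k + 1 - δ + 1) = C
  generalize rGamma (b + δ) = D
  generalize Complex.Gamma (b + k) = G
  generalize (s : ℂ) ^ (-(b + k)) = S
  generalize (s : ℂ)⁻¹ = T
  linear_combination (-1) ^ k * (-1) * T * S * C * (b + k) * D * G * (1 - δ + k) * (1 + k) * h1

/-- The difference of the two families. -/
noncomputable def diffGen (s : ℝ) (b d : ℂ) (k : ℕ) (δ : ℂ) : ℂ :=
  rightGen s b d k δ - Complex.Gamma d * leftGen s b d k δ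

theorem exists_diffGen_bound {s : ℝ} (hs : 1 < s) {b : ℂ} (hb : 0 < b.re) (d : ℂ) :
    ∃ u : ℕ → ℝ, Summable u ∧ ∀ k, ∀ δ ∈ Metric.closedBall (0 : ℂ) 1, ‖diffGen s b d k δ‖ ≤ u k := by
  have hs' : 0 < s := by linarith
  have hK := isCompact_closedBall (0 : ℂ) 1
  obtain ⟨u, hu, hule⟩ := exists_summable_bound_of_rational_ratio₃ hK (norm_neg_inv_lt_one hs)
    (f := leftGen s b d) (n₁ := fun δ ↦ b + δ) (n₂ := fun δ ↦ 1 - d + δ) (n₃ := fun _ ↦ 1)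
    (d₁ := fun _ ↦ 1) (d₂ := fun δ ↦ 1 + δ) (d₃ := fun _ ↦ 1)
    (fun k ↦ (differentiable_leftGen hs' b d k).continuous.continuousOn) (by fun_prop) (by fun_prop)
    (by fun_prop) (by fun_prop) (by fun_prop) (by fun_prop) fun k δ _ ↦ leftGen_succ hs' b d k δ
  obtain ⟨v, hv, hvle⟩ := exists_summable_bound_of_rational_ratio₃ hK (norm_neg_inv_lt_one hs)
    (f := rightGen s b d) (n₁ := fun _ ↦ 1 - d) (n₂ := fun _ ↦ b) (n₃ := fun _ ↦ 1)
    (d₁ := fun _ ↦ 1) (d₂ := fun δ ↦ 1 - δ) (d₃ := fun _ ↦ 1)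
    (fun k ↦ (differentiable_rightGen s b d k).continuous.continuousOn) (by fun_prop) (by fun_prop)
    (by fun_prop) (by fun_prop) (by fun_prop) (by fun_prop) fun k δ _ ↦ rightGen_succ hs' hb d k δ
  refine ⟨fun k ↦ v k + ‖Complex.Gamma d‖ * u k, hv.add (hu.mul_left _), fun k δ hδ ↦ ?_⟩
  refine (norm_sub_le _ _).trans ?_
  rw [norm_mul]
  exact add_le_add (hvle k δ hδ) (mul_le_mul_of_nonneg_left (hule k δ hδ) (norm_nonneg _))

/-- Reflection formula. Applied at z = -δ and z = δ, it extracts the same singular factor from both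
series, with opposite signs. -/
theorem Gamma_sub_natCast_eq {z : ℂ} (hz : z.re < 1) (k : ℕ) :
    Complex.Gamma (z - k) = (-1) ^ k * (Real.pi / Complex.sin (Real.pi * z)) * rGamma (k + 1 - z) := by
  have hsin : Complex.sin (Real.pi * (z - k)) = (-1) ^ k * Complex.sin (Real.pi * z) := by
    rw [mul_sub, mul_comm (Real.pi : ℂ) k, Complex.sin_antiperiodic.sub_nat_mul_eq]
  have h := Complex.Gamma_mul_Gamma_one_sub (z - k)
  rw [hsin, show 1 - (z - k) = k + 1 - z by ring] at h
  have h1 : ((-1 : ℂ) ^ k)⁻¹ = (-1) ^ k := by rw [← inv_pow]; norm_num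
  rw [div_mul_eq_div_div_swap, div_eq_mul_inv _ ((-1 : ℂ) ^ k), h1] at h
  have h0 : Complex.Gamma (k + 1 - z) ≠ 0 := by
    refine Complex.Gamma_ne_zero_of_re_pos ?_
    simp only [Complex.sub_re, Complex.add_re, Complex.natCast_re, Complex.one_re]
    linarith [(Nat.cast_nonneg k : (0 : ℝ) ≤ k)]
  rw [rGamma, mul_comm ((-1 : ℂ) ^ k), ← h, mul_inv_cancel_right₀ h0]

theorem eulerIntegral_eq_tsum_diffGen {s : ℝ} (hs : 1 < s) {b d : ℂ} (hb : 0 < b.re)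
    (hd : 1 < d.re) {δ : ℝ} (hδ : 0 < δ) (hδ1 : δ < 1) :
    eulerIntegral (b + δ) b d (-s) =
      Real.pi / Complex.sin (Real.pi * δ) * ∑' k, diffGen s b d k δ := by
  have hs0 : (s : ℂ) ≠ 0 := by exact_mod_cast (by linarith : s ≠ 0)
  obtain ⟨Y, h1, h2⟩ := eulerIntegral_neg_expansion (a := b + δ) hb (by simpa using hδ)
    (by simpa using hδ1) hd hs
  have h3 := (h1.mul_left ((s : ℂ) ^ (-(b + δ)))).add h2
  rw [add_sub_cancel] at h3
  rw [← tsum_mul_left, ← h3.tsum_eq]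
  refine tsum_congr fun k ↦ ?_
  have e1 : gammaBeta (b - (b + δ) - k) d = -((-1) ^ k * (Real.pi / Complex.sin (Real.pi * δ))) *
      rGamma (k + 1 + δ) * Complex.Gamma d * rGamma (d - k - δ) := by
    rw [gammaBeta, show b - (b + δ) - (k : ℂ) = -(δ : ℂ) - k by ring,
      Gamma_sub_natCast_eq (by simp; linarith),
      mul_neg, Complex.sin_neg, sub_neg_eq_add, ← rGamma, show -(δ : ℂ) - k + d = d - k - δ by ring,
      div_neg]
    ring
  have e2 : gammaBeta (b + k) (b + δ - (b + k)) = Complex.Gamma (b + k) *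
      ((-1) ^ k * (Real.pi / Complex.sin (Real.pi * δ)) * rGamma (k + 1 - δ)) * rGamma (b + δ) := by
    rw [gammaBeta, show b + δ - (b + (k : ℂ)) = δ - k by ring,
      Gamma_sub_natCast_eq (by simpa using hδ1), ← rGamma,
      show b + k + (δ - (k : ℂ)) = b + δ by ring]
  have e3 : (s : ℂ) ^ (-(b + k + δ)) = (s : ℂ) ^ (-(b + δ)) * ((s : ℂ)⁻¹) ^ k := by
    rw [show -(b + k + δ) = -(b + δ) + -(k : ℂ) by ring, Complex.cpow_add _ _ hs0,
      Complex.cpow_neg _ (k : ℂ), Complex.cpow_natCast, inv_pow]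
  have e4 : ((-1 : ℂ) ^ k) * (-1) ^ k = 1 := by rw [← mul_pow]; simp
  rw [e1, e2, diffGen, leftGen, rightGen, e3, invCoef, neg_pow]
  generalize Real.pi / Complex.sin (Real.pi * δ) = π'
  linear_combination (-(s : ℂ) ^ (-(b + δ)) * binCoef (b + δ) k * ((s : ℂ)⁻¹) ^ k * π' *
    rGamma (k + 1 + δ) * Complex.Gamma d * rGamma (d - k - δ)) * e4

theorem diffGen_zero (s : ℝ) {b d : ℂ} (hb : 0 < b.re) (hd : 0 < d.re) (k : ℕ) :
    diffGen s b d k 0 = 0 := by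
  have h1 := Gamma_add_natCast (ne_neg_natCast_of_re_pos hb) k
  have h2 := rGamma_sub_natCast d k
  have h3 : Complex.Gamma d * rGamma d = 1 :=
    mul_inv_cancel₀ (Complex.Gamma_ne_zero_of_re_pos hd)
  have h4 : Complex.Gamma b * rGamma b = 1 :=
    mul_inv_cancel₀ (Complex.Gamma_ne_zero_of_re_pos hb)
  simp only [diffGen, leftGen, rightGen, add_zero, sub_zero, binCoef]
  rw [h1, h2]
  linear_combination ((-1) ^ k * ((ascPochhammer ℂ k).eval (1 - d) / (Nat.factorial k : ℂ)) *
    (s : ℂ) ^ (-(b + k)) * (ascPochhammer ℂ k).eval b * rGamma (k + 1)) * (h4 - h3)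

theorem deriv_diffGen {s : ℝ} (hs : 0 < s) {b d : ℂ} (hb : 0 < b.re) (hd : 0 < d.re) (k : ℕ) :
    Complex.Gamma (b + d) * rGamma b * rGamma d * deriv (diffGen s b d k) 0 =
      limitTerm s b (b + d) k := by
  have hp := ((differentiable_ascPochhammer_eval k) b).hasDerivAt
  set P' := deriv (fun z ↦ (ascPochhammer ℂ k).eval z) b with hP'
  set P := (ascPochhammer ℂ k).eval b with hP
  have hp' : HasDerivAt (fun δ : ℂ ↦ (ascPochhammer ℂ k).eval (b + δ)) P' 0 := by
    have := HasDerivAt.comp_const_add b 0 (by simpa using hp)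
    simpa using this
  -- Differentiating (z)ₖ / Γ(z+k) = 1/Γ(z) at b trades the derivatives of the Pochhammer symbol and
  -- of 1/Γ at b for that of 1/Γ at b + k.
  have hrec : P' * rGamma (b + k) + P * deriv rGamma (b + k) = deriv rGamma b := by
    have h1 := hp.mul ((hasDerivAt_rGamma (b + k)).comp_add_const b k)
    have h2 : (fun z ↦ (ascPochhammer ℂ k).eval z) * (fun z ↦ rGamma (z + k)) = rGamma :=
      funext fun z ↦ ascPochhammer_mul_rGamma z k
    rw [h2] at h1
    exact h1.unique (hasDerivAt_rGamma b)
  have h1 := hasDerivAt_rGamma_const_sub (k + 1) 0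
  have h2 := hasDerivAt_rGamma_const_add b 0
  have h3 := hasDerivAt_rGamma_const_add (k + 1) 0
  have h4 := hasDerivAt_rGamma_const_sub (d - k) 0
  have h5 := hasDerivAt_const_cpow_neg hs (b + k) 0
  have hL := ((hp'.div_const (Nat.factorial k : ℂ)).mul h5).mul (h3.mul h4)
  have hR := (h1.mul h2).const_mul ((-1) ^ k * binCoef (1 - d) k * (s : ℂ) ^ (-(b + k)) *
    Complex.Gamma (b + k))
  have hD := hR.sub (hL.const_mul (Complex.Gamma d))
  have hD' : deriv (diffGen s b d k) 0 = _ := HasDerivAt.deriv hD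
  rw [hD', limitTerm_eq hs, expGenDeriv]
  simp only [Pi.mul_apply, sub_zero, add_zero]
  have hG : Complex.Gamma (b + k) * rGamma (b + k) = 1 := by
    refine mul_inv_cancel₀ (Complex.Gamma_ne_zero_of_re_pos ?_)
    simp only [Complex.add_re, Complex.natCast_re]
    positivity
  have hGd : Complex.Gamma d * rGamma d = 1 :=
    mul_inv_cancel₀ (Complex.Gamma_ne_zero_of_re_pos hd)
  have hPR : P * rGamma (b + k) = rGamma b := ascPochhammer_mul_rGamma b k
  have hdk : (-1) ^ k * binCoef (1 - d) k * rGamma d = rGamma (d - k) * rGamma (k + 1) := by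
    rw [rGamma_sub_natCast, rGamma_natCast_add_one, binCoef]
    ring
  have hfac : P / (Nat.factorial k : ℂ) = P * rGamma (k + 1) := by
    rw [rGamma_natCast_add_one, div_eq_mul_inv]
  have hfac' : P' / (Nat.factorial k : ℂ) = P' * rGamma (k + 1) := by
    rw [rGamma_natCast_add_one, div_eq_mul_inv]
  rw [hfac, hfac', show b + d - b - (k : ℂ) = d - k by ring, ← hPR, ← hrec]
  generalize binCoef (1 - d) k = D at *
  generalize Complex.Gamma (b + k) = G at *
  generalize Complex.Gamma (b + d) = Gc at *
  generalize Complex.Gamma d = Gd at *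
  generalize rGamma (b + k) = Rb at *
  generalize rGamma (d - k) = Rdk at *
  generalize rGamma (k + 1) = Rk at *
  generalize rGamma d = Rd at *
  generalize (s : ℂ) ^ (-(b + k)) = S at *
  generalize deriv rGamma (b + k) = Rb' at *
  generalize deriv rGamma (d - k) = Rdk' at *
  generalize deriv rGamma (k + 1) = Rk' at *
  generalize (Real.log s : ℂ) = Lg at *
  linear_combination Gc * P * Rb * S * G * (-Rk' * P * Rb + Rk * (P' * Rb + P * Rb')) * hdk +
    Gc * P * S * Rdk * Rk * (-Rk' * P * Rb + Rk * (P' * Rb + P * Rb')) * hG -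
    Gc * P * Rb * (P' * Rk * S * Rk * Rdk - P * Rk * S * Lg * Rk * Rdk + P * Rk * S * Rk' * Rdk -
      P * Rk * S * Rk * Rdk') * hGd

theorem differentiable_eulerIntegral_left {b d : ℂ} (hb : 0 < b.re) (hd : 0 < d.re) {z : ℂ}
    (hz : z ∈ cutPlane) : Differentiable ℂ fun a ↦ eulerIntegral a b d z := by
  have hsl : ∀ t ∈ Set.Icc (0 : ℝ) 1, 1 - z * (t : ℂ) ∈ Complex.slitPlane :=
    fun t ht ↦ one_sub_mem_slitPlane (mul_mem_cutPlane hz ht)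
  have hc : ContinuousOn (fun p : ℂ × ℝ ↦ (1 - z * (p.2 : ℂ)) ^ (-p.1))
      (Set.univ ×ˢ Set.Icc (0 : ℝ) 1) :=
    ContinuousOn.cpow (by fun_prop) (by fun_prop) fun p hp ↦ hsl p.2 hp.2
  refine differentiableOn_univ.1 (differentiableOn_intervalIntegral_mul
    (Complex.betaIntegral_convergent hb hd) isOpen_univ (φ := fun a t ↦ (1 - z * t) ^ (-a))
    (φ' := fun a t ↦ (1 - z * t) ^ (-a) * Complex.log (1 - z * t) * -1) hc ?_ ?_)
  · exact (hc.mul (ContinuousOn.clog (by fun_prop) fun p hp ↦ hsl p.2 hp.2)).mul continuousOn_const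
  · intro a _ t ht
    exact (hasDerivAt_neg a).const_cpow (Or.inl (Complex.slitPlane_ne_zero (hsl t ht)))

theorem neg_ofReal_mem_cutPlane {s : ℝ} (hs : 0 < s) : -(s : ℂ) ∈ cutPlane := by
  intro x hx h
  have : -s = x := by exact_mod_cast h
  linarith

/-- Let Ψ be the sum of the `diffGen` terms. Since Ψ(0) = 0, (π / sin(πδ)) Ψ(δ) tends to Ψ'(0), and
the uniform bound on the disc allows Ψ to be differentiated termwise. Euler's integral is continuous
in its first parameter, so letting δ → 0⁺ identifies the limit. -/
theorem hasSum_deriv_diffGen {s : ℝ} (hs : 1 < s) {b d : ℂ} (hb : 0 < b.re) (hd : 1 < d.re) :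
    HasSum (fun k ↦ deriv (diffGen s b d k) 0) (eulerIntegral b b d (-s)) := by
  obtain ⟨u, hu, hle⟩ := exists_diffGen_bound hs hb d
  have hdiff : ∀ k, DifferentiableOn ℂ (diffGen s b d k) (Metric.ball 0 1) := fun k ↦
    ((differentiable_rightGen s b d k).sub
      ((differentiable_leftGen (by linarith) b d k).const_mul _)).differentiableOn
  have hle' : ∀ k, ∀ δ ∈ Metric.ball (0 : ℂ) 1, ‖diffGen s b d k δ‖ ≤ u k := fun k δ hδ ↦
    hle k δ (Metric.ball_subset_closedBall hδ)
  have hsum := Complex.hasSum_deriv_of_summable_norm hu hdiff Metric.isOpen_ball hle'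
    (Metric.mem_ball_self one_pos)
  have hΨ : HasDerivAt (fun δ ↦ ∑' k, diffGen s b d k δ)
      (deriv (fun δ ↦ ∑' k, diffGen s b d k δ) 0) 0 :=
    ((Complex.differentiableOn_tsum_of_summable_norm hu hdiff Metric.isOpen_ball
      hle').differentiableAt (Metric.ball_mem_nhds 0 one_pos)).hasDerivAt
  have hsin : HasDerivAt (fun δ : ℂ ↦ Complex.sin (Real.pi * δ)) Real.pi 0 := by
    have := ((hasDerivAt_id (0 : ℂ)).const_mul (Real.pi : ℂ)).csin
    simpa using! this
  have hpi : (Real.pi : ℂ) ≠ 0 := by exact_mod_cast Real.pi_ne_zero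
  have hreal : Tendsto (fun δ : ℝ ↦ (δ : ℂ)) (𝓝[>] 0) (𝓝[≠] 0) := by
    rw [tendsto_nhdsWithin_iff]
    refine ⟨?_, ?_⟩
    · exact (Complex.continuous_ofReal.tendsto' 0 0 Complex.ofReal_zero).mono_left
        nhdsWithin_le_nhds
    · filter_upwards [self_mem_nhdsWithin] with δ hδ
      exact Complex.ofReal_ne_zero.2 (ne_of_gt hδ)
  have hΨ0 : ∑' k, diffGen s b d k 0 = 0 := by
    simp [diffGen_zero s hb (by linarith : 0 < d.re)]
  have hlim : Tendsto (fun δ : ℂ ↦ Real.pi / Complex.sin (Real.pi * δ) * ∑' k, diffGen s b d k δ)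
      (𝓝[≠] 0) (𝓝 (deriv (fun δ ↦ ∑' k, diffGen s b d k δ) 0)) := by
    have h := ((hasDerivAt_iff_tendsto_slope.1 hΨ).div (hasDerivAt_iff_tendsto_slope.1 hsin)
      hpi).const_mul (Real.pi : ℂ)
    rw [mul_div_cancel₀ _ hpi] at h
    refine h.congr' ?_
    filter_upwards [self_mem_nhdsWithin] with δ hδ
    have hδ0 : δ ≠ 0 := hδ
    simp only [slope_def_field, Pi.div_apply, hΨ0, mul_zero, Complex.sin_zero, sub_zero]
    rw [div_div_div_cancel_right₀ hδ0]
    ring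
  have hlhs : Tendsto (fun δ : ℝ ↦ eulerIntegral (b + δ) b d (-s)) (𝓝[>] 0)
      (𝓝 (eulerIntegral b b d (-s))) := by
    have hc := (differentiable_eulerIntegral_left hb (by linarith : 0 < d.re)
      (neg_ofReal_mem_cutPlane (by linarith : 0 < s))).continuous
    have : Continuous fun δ : ℝ ↦ eulerIntegral (b + δ) b d (-s) :=
      hc.comp (by fun_prop : Continuous fun δ : ℝ ↦ b + (δ : ℂ))
    exact (this.tendsto' 0 _ (by simp)).mono_left nhdsWithin_le_nhds
  have huniq := tendsto_nhds_unique hlhs (((hlim.comp hreal)).congr' ?_)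
  · rw [huniq]
    exact hsum
  · filter_upwards [Ioo_mem_nhdsGT one_pos] with δ hδ
    exact (eulerIntegral_eq_tsum_diffGen hs hb hd hδ.1 hδ.2).symm

theorem gaussHyp_eq_eulerIntegral (a : ℂ) {b c z : ℂ} (hb : 0 < b.re) (hbc : b.re < c.re)
    (hz : z ∈ cutPlane) :
    gaussHyp a b c z = eulerIntegral a b (c - b) z / Complex.betaIntegral b (c - b) :=
  (isGaussContinuation_gaussHyp a b (ne_neg_natCast_of_re_pos (hb.trans hbc))).eqOn
    (isGaussContinuation_eulerIntegral a hb hbc) hz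

theorem gaussHyp_eq_tsum_of_re_pos {s : ℝ} (hs : 1 < s) {a c : ℂ} (ha : 0 < a.re)
    (hac : a.re + 1 < c.re) : gaussHyp a a c (-s) = ∑' k, limitTerm s a c k := by
  have hd : 1 < (c - a).re := by simp; linarith
  have hd0 : 0 < (c - a).re := by linarith
  rw [gaussHyp_eq_eulerIntegral a ha (by linarith) (neg_ofReal_mem_cutPlane (by linarith)),
    Complex.betaIntegral_eq_Gamma_mul_div _ _ ha hd0, ← (hasSum_deriv_diffGen hs ha hd).tsum_eq,
    div_div_eq_mul_div, ← tsum_mul_right, ← tsum_div_const]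
  refine tsum_congr fun k ↦ ?_
  have h := deriv_diffGen (by linarith : 0 < s) ha hd0 k
  rw [add_sub_cancel] at h ⊢
  rw [← h, rGamma, rGamma]
  field_simp

theorem gaussHyp_eq_tsum_limitTerm {s : ℝ} (hs : 1 < s) (a : ℂ) {c : ℂ} (hc : c ∈ nonpolar) :
    gaussHyp a a c (-s) = ∑' k, limitTerm s a c k := by
  have hz : (-(s : ℂ)).re < 1 / 2 := by simp; linarith
  rw [gaussHyp_eq_pfaffSum a c hc hz]
  -- The margin r = 1 is the condition re (c - a) > 1 under which the confluent expansion was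
  -- derived.
  refine eq_of_holomorphic_params (f := pfaffSum (-s)) (g := fun a c ↦ ∑' k, limitTerm s a c k) 1
    zero_le_one (fun c hc ↦ differentiable_pfaffSum_left hz hc)
    (fun c hc ↦ differentiable_tsum_limitTerm_left hs hc)
    (fun a ↦ differentiableOn_pfaffSum_right hz a)
    (fun a ↦ differentiableOn_tsum_limitTerm_right hs a) (fun a c ha hac ↦ ?_) a c hc
  rw [← gaussHyp_eq_pfaffSum a c (ne_neg_natCast_of_re_pos (by linarith)) hz]
  exact gaussHyp_eq_tsum_of_re_pos hs ha hac

/-! ### Identification with the digamma summands. -/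

theorem continuousAt_limitTerm {s : ℝ} (hs : 0 < s) (k : ℕ) {p : ℂ × ℂ} (hp : p.2 ∈ nonpolar) :
    ContinuousAt (fun p : ℂ × ℂ ↦ limitTerm s p.1 p.2 k) p := by
  simp_rw [limitTerm_eq hs]
  refine ContinuousAt.mul ?_ (continuous_expGenDeriv hs k).continuousAt
  exact (ContinuousAt.comp (g := Complex.Gamma) (Complex.differentiableAt_Gamma p.2 hp).continuousAt
    continuous_snd.continuousAt).neg

theorem deriv_rGamma {z : ℂ} (hz : z ∈ nonpolar) :
    deriv rGamma z = -(Complex.digamma z * rGamma z) := by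
  have h0 := Complex.Gamma_ne_zero hz
  have h := ((Complex.differentiableAt_Gamma z hz).hasDerivAt.inv h0).deriv
  refine (show deriv rGamma z = _ from h).trans ?_
  rw [Complex.digamma_def, logDeriv_apply, rGamma]
  field_simp

/-- At z = c - a this collapses the last three digamma values of the summand to -Ψ(c-a-k), the
logarithmic derivative that comes out of `expGen`. Both sides have the same increments in k. -/
theorem digamma_sub_natCast {z : ℂ} (hz : ∀ n : ℤ, z ≠ n) (k : ℕ) :
    Complex.digamma (z - k) =
      Complex.digamma z + Complex.digamma (1 - z + k) - Complex.digamma (1 - z) := by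
  induction k with
  | zero => simp
  | succ k ih =>
    have h1 := Complex.digamma_apply_add_one (z - (k + 1)) fun m h ↦ hz (k + 1 - m) (by
      push_cast
      linear_combination h)
    have h2 := Complex.digamma_apply_add_one (1 - z + k) fun m h ↦ hz (1 + k + m) (by
      push_cast
      linear_combination -h)
    have h3 : (z - (k + 1) : ℂ)⁻¹ = -(1 - z + k : ℂ)⁻¹ := by
      rw [← inv_neg]
      congr 1
      ring
    rw [show z - ((k : ℂ) + 1) + 1 = z - k by ring, ih, h3] at h1
    push_cast
    rw [← add_assoc (1 - z), h2]
    linear_combination -h1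

theorem expansionFactor_mul_expansionTerm {a c : ℂ} (h : (a, c) ∈ regularParams) {w : ℝ}
    (hw : w < 0) (k : ℕ) :
    expansionFactor a c w * expansionTerm a c w k = limitTerm (-w) a c k := by
  obtain ⟨ha, hc, hca⟩ := h
  simp only at ha hc hca
  have hs0 : ((-w : ℝ) : ℂ) ≠ 0 := by exact_mod_cast (by linarith : -w ≠ 0)
  have hak : a + k ∈ nonpolar := fun n hn ↦ ha (n + k) (by
    push_cast
    linear_combination hn)
  have hdk : c - a - k ∈ nonpolar := fun n hn ↦ hca (k - n) (by
    push_cast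
    linear_combination hn)
  have hk1 : (k : ℂ) + 1 ∈ nonpolar := ne_neg_natCast_of_re_pos (by
    simp only [Complex.add_re, Complex.natCast_re, Complex.one_re]
    positivity)
  rw [limitTerm_eq (by linarith), expGenDeriv, deriv_rGamma hak, deriv_rGamma hdk, deriv_rGamma hk1,
    digamma_sub_natCast hca k, expansionFactor, expansionTerm]
  have e1 : ((w : ℂ) ^ k)⁻¹ = (-1) ^ k * (((-w : ℝ) : ℂ) ^ k)⁻¹ := by
    rw [show (w : ℂ) = -1 * ((-w : ℝ) : ℂ) by push_cast; ring, mul_pow, mul_inv, ← inv_pow (-1 : ℂ)]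
    norm_num
  have e2 : ((-w : ℝ) : ℂ) ^ (-(a + k)) = ((-w : ℝ) : ℂ) ^ (-a) * (((-w : ℝ) : ℂ) ^ k)⁻¹ := by
    rw [neg_add, Complex.cpow_add _ _ hs0, Complex.cpow_neg _ (k : ℂ), Complex.cpow_natCast]
  have e3 := ascPochhammer_mul_rGamma a k
  have e4 := rGamma_sub_natCast (c - a) k
  have e5 := rGamma_natCast_add_one k
  rw [show 1 - (c - a) = a - c + 1 by ring] at e4 ⊢
  have e6 : Complex.Gamma c / (Complex.Gamma a * Complex.Gamma (c - a)) =
      Complex.Gamma c * rGamma a * rGamma (c - a) := by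
    rw [rGamma, rGamma, div_eq_mul_inv, mul_inv]
    ring
  rw [e1, e2, e4, e5, e6, ← e3]
  generalize rGamma (a + k) = Ra
  generalize rGamma (c - a) = Rd
  generalize ((-w : ℝ) : ℂ) ^ (-a) = S
  generalize (ascPochhammer ℂ k).eval a = P
  generalize (ascPochhammer ℂ k).eval (a - c + 1) = Q
  generalize (-1 : ℂ) ^ k = ε
  ring

theorem expansionFactor_ne_zero {a c : ℂ} (h : (a, c) ∈ regularParams) {w : ℝ} (hw : w < 0) :
    expansionFactor a c w ≠ 0 := by
  obtain ⟨ha, hc, hca⟩ := h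
  have hs0 : ((-w : ℝ) : ℂ) ≠ 0 := by exact_mod_cast (by linarith : -w ≠ 0)
  refine mul_ne_zero (fun h ↦ hs0 ((Complex.cpow_eq_zero_iff _ _).1 h).1)
    (div_ne_zero (Complex.Gamma_ne_zero hc) (mul_ne_zero (Complex.Gamma_ne_zero ha)
      (Complex.Gamma_ne_zero fun n hn ↦ hca (-n) (by push_cast; exact hn))))

theorem theorem2p5 (a c : ℂ) (hc : ∀ n : ℕ, c ≠ -(n : ℂ)) (w : ℝ) (hw : w < -1) :
    -- `₂F₁(a, a; c; ·)` is well defined on `ℂ ∖ [1, ∞)`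
    IsGaussContinuation a a c (gaussHyp a a c) ∧
    -- the expansion, wherever all gamma and digamma values in it are defined
    ((a, c) ∈ regularParams →
      Summable (fun k : ℕ ↦ ‖expansionTerm a c w k‖) ∧
      gaussHyp a a c (w : ℂ) = expansionFactor a c w * ∑' k : ℕ, expansionTerm a c w k) ∧
    -- the expansion for all parameters, its summands being extended by continuity
    (∃ t : ℕ → ℂ,
      (∀ k : ℕ, Tendsto (fun p : ℂ × ℂ ↦ expansionFactor p.1 p.2 w * expansionTerm p.1 p.2 w k)
        (𝓝[regularParams] (a, c)) (𝓝 (t k))) ∧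
      Summable (fun k : ℕ ↦ ‖t k‖) ∧
      gaussHyp a a c (w : ℂ) = ∑' k : ℕ, t k) := by
  have hs : 1 < -w := by linarith
  have hsum := summable_norm_limitTerm hs a hc
  have hval : gaussHyp a a c (w : ℂ) = ∑' k, limitTerm (-w) a c k := by
    rw [← gaussHyp_eq_tsum_limitTerm hs a hc]
    push_cast
    rw [neg_neg]
  refine ⟨isGaussContinuation_gaussHyp a a hc, fun hreg ↦ ⟨?_, ?_⟩, limitTerm (-w) a c,
    fun k ↦ ?_, hsum, hval⟩
  -- The factor in front is nonzero, so absolute convergence of the products passes to the summands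
  -- alone.
  · have h0 := expansionFactor_ne_zero hreg (by linarith : w < 0)
    refine (hsum.mul_left ‖expansionFactor a c w‖⁻¹).congr fun k ↦ ?_
    rw [← expansionFactor_mul_expansionTerm hreg (by linarith), norm_mul,
      inv_mul_cancel_left₀ (norm_ne_zero_iff.2 h0)]
  · rw [hval, ← tsum_mul_left]
    exact tsum_congr fun k ↦ (expansionFactor_mul_expansionTerm hreg (by linarith) k).symm
  · refine ((continuousAt_limitTerm (by linarith) k (p := (a, c)) hc).tendsto.mono_left
      nhdsWithin_le_nhds).congr' ?_
    filter_upwards [self_mem_nhdsWithin] with p hp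
    exact (expansionFactor_mul_expansionTerm hp (by linarith) k).symm
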